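/- **Setting.** Let $V\neq 0$ be a finite-dimensional complex Hilbert space; operators on $V$ carry the operator norm $\|\cdot\|$, and $\overline{\mathrm{Tr}}\,O=\mathrm{Tr}\,O/\mathrm{Tr}\,I$. There are $n$ sites, and to each site $i$ belongs a set $\mathcal G_i$ of operators on $V$ (for qubits, the Pauli operators of the $i$-th qubit; for fermions, the $i$-th Majorana operator). The support $\mathrm{supp}(X)$ of an operator $X$ is the set of sites $i$ such that $X$ is not in the unital algebra generated by $\bigcup_{j\ne i}\mathcal G_j$. Let $\Gamma$ and $A$ be finite index sets, $k\ge 0$ an integer and $a_{\mathrm{loc}},a_{\mathrm{ac}}$ real numbers. Let $H_\gamma$ ($\gamma\in\Gamma$) and $A^a$ ($a\in A$) be operators on $V$ satisfying the following. 1. (Symmetric random Hamiltonian.) Each $H_\gamma$ is Hermitian with $H_\gamma^2=h_\gamma^2 I$, $h_\gamma\ge 0$. The signs $s_\gamma\in\{1,-1\}$ are independent and uniform, and $H=\sum_{\gamma}s_\gamma H_\gamma$. 2. (Commuting or anticommuting.) Each $A^a$ is Hermitian with $(A^a)^2=I$. There are numbers $b_{a\gamma},b_{\gamma\gamma'}\in\{0,1\}$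 with $[A^a,H_\gamma]=2b_{a\gamma}A^aH_\gamma$ and $[H_\gamma,H_{\gamma'}]=2b_{\gamma\gamma'}H_\gamma H_{\gamma'}$; moreover $b_{a\gamma}=0$ if $A^a$ and $H_\gamma$ have disjoint supports, and $b_{\gamma\gamma'}=0$ if $H_\gamma$ and $H_{\gamma'}$ have disjoint supports. 3. (Locality.) $|\mathrm{supp}(A^a)|=1$ for all $a$; $|\mathrm{supp}(H_\gamma)|=k$ and $\sum_{a}b_{a\gamma}=a_{\mathrm{ac}}k$ for all $\gamma$; for every set $Z$ of sites exactly $a_{\mathrm{loc}}|Z|$ of the $A^a$ have a support that meets $Z$; and $a_{\mathrm{ac}}\le a_{\mathrm{loc}}$. For $y\in\mathbb R$ let $K^a=A^a+y[A^a,H]$ and let $$\mathcal L^\dagger(O)=\sum_{a\in A}\Big(K^{a\dagger}OK^a-\tfrac12\big(K^{a\dagger}K^aO+OK^{a\dagger}K^a\big)\Big)$$ (a random superoperator, through the signs). Let $\|H\|_{\mathrm{loc}}=\max_i\big(\sum_{\gamma:\,i\in \mathrm{supp}(H_\gamma)}h_\gamma^2\big)^{1/2}$ (which is $0$ if $n=0$).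 **Proposition.** There is a universal constant $C$ (independent of all the data above and of $y,t,U$ below) such that the following holds. Let $y,t\in\mathbb R$ satisfy $t\ge 0$, $a_{\mathrm{loc}}kt<1$ and $y^2\|H\|_{\mathrm{loc}}^2a_{\mathrm{loc}}k<1/8$, and let $U\subset\Gamma$ with $|U|\le 5$. Then the linear functional $$O\ \longmapsto\ \mathbb E\Big[\Big(\prod_{\alpha\in U}s_\alpha\Big)\,\overline{\mathrm{Tr}}\int_0^t\!\!\int_0^{t_2}e^{t_1\mathcal L^\dagger}(O)\,dt_1\,dt_2\Big]$$ on the operators on $V$, with the norm $\sup_{O\ne0}|\cdot|/\|O\|$, has norm at most $C\,t^2\,|y|^{|U|}\prod_{\alpha\in U}h_\alpha$. -/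

import Mathlib

noncomputable section

namespace RandomLindblad

/-- A system of `n` sites on the Hilbert space `V` is described by the operators `site i` that live
on the site `i`: the single-qubit Pauli operators of the `i`-th qubit for a spin system, the single
Majorana operator `χ i` for a fermionic one.  The support of an operator `X` is the set of sites on
which `X` acts nontrivially, i.e. the sites `i` such that `X` is not in the unital algebra generated
by the operators of the other sites. -/
def opSupport {V : Type*} [NormedAddCommGroup V] [InnerProductSpace ℂ V] {n : ℕ}
    (site : Fin n → Set (V →L[ℂ] V)) (X : V →L[ℂ] V) : Finset (Fin n) :=
  open Classical in
  {i : Fin n | X ∉ Algebra.adjoin ℂ (⋃ j : {j : Fin n // j ≠ i}, site j)}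

/-- The terms `H γ` are Hermitian and square to `h γ ^ 2` times the identity. -/
structure SymmetricTerms {V : Type*} [NormedAddCommGroup V] [InnerProductSpace ℂ V]
    [CompleteSpace V] {Γ : Type*} (H : Γ → V →L[ℂ] V) (h : Γ → ℝ) : Prop where
  selfAdjoint : ∀ γ, IsSelfAdjoint (H γ)
  strength_nonneg : ∀ γ, 0 ≤ h γ
  sq_eq : ∀ γ, H γ * H γ = ((h γ ^ 2 : ℝ) : ℂ) • (1 : V →L[ℂ] V)

/-- The jump operators `A a` are Hermitian involutions; each jump and each Hamiltonian term, and
each pair of Hamiltonian terms, commute (`b = 0`) or anticommute (`b = 1`), and `b = 0` when the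
supports are disjoint. -/
structure CommuteOrAnticommute {V : Type*} [NormedAddCommGroup V] [InnerProductSpace ℂ V]
    [CompleteSpace V] {n : ℕ} {Γ J : Type*} (site : Fin n → Set (V →L[ℂ] V))
    (H : Γ → V →L[ℂ] V) (A : J → V →L[ℂ] V) (b : J → Γ → ℕ) (b' : Γ → Γ → ℕ) : Prop where
  jump_selfAdjoint : ∀ a, IsSelfAdjoint (A a)
  jump_sq : ∀ a, A a * A a = 1
  jump_zero_or_one : ∀ a γ, b a γ = 0 ∨ b a γ = 1
  jump_comm : ∀ a γ, A a * H γ - H γ * A a = ((b a γ : ℂ) * 2) • (A a * H γ)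
  term_zero_or_one : ∀ γ γ', b' γ γ' = 0 ∨ b' γ γ' = 1
  term_comm : ∀ γ γ', H γ * H γ' - H γ' * H γ = ((b' γ γ' : ℂ) * 2) • (H γ * H γ')
  term_disjoint : ∀ γ γ', Disjoint (opSupport site (H γ)) (opSupport site (H γ')) → b' γ γ' = 0
  jump_disjoint : ∀ a γ, Disjoint (opSupport site (A a)) (opSupport site (H γ)) → b a γ = 0

/-- Every jump is supported on one site, every Hamiltonian term on `k` sites; each term
anticommutes with `aac * k` jumps, and for each set `Z` of sites there are `aloc * |Z|` jumps whose
support meets `Z`. -/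
structure LocalJumps {V : Type*} [NormedAddCommGroup V] [InnerProductSpace ℂ V]
    {n : ℕ} {Γ J : Type*} [Fintype J] (site : Fin n → Set (V →L[ℂ] V))
    (H : Γ → V →L[ℂ] V) (A : J → V →L[ℂ] V) (b : J → Γ → ℕ)
    (k : ℕ) (aloc aac : ℝ) : Prop where
  jump_card : ∀ a, (opSupport site (A a)).card = 1
  term_card : ∀ γ, (opSupport site (H γ)).card = k
  aac_le_aloc : aac ≤ aloc
  sum_anticommuting : ∀ γ, ∑ a, (b a γ : ℝ) = aac * k
  card_jumps : ∀ Z : Finset (Fin n),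
    (Nat.card {a : J // (opSupport site (A a) ∩ Z).Nonempty} : ℝ) = aloc * Z.card

/-- The local energy: the maximum over the sites `i` of the square root of the sum of `h γ ^ 2` over
the terms whose support contains `i` (it is `0` if there are no sites). -/
def localEnergy {V : Type*} [NormedAddCommGroup V] [InnerProductSpace ℂ V] {n : ℕ}
    {Γ : Type*} [Fintype Γ] (site : Fin n → Set (V →L[ℂ] V)) (H : Γ → V →L[ℂ] V)
    (h : Γ → ℝ) : ℝ :=
  ⨆ i : Fin n, √(∑ γ with i ∈ opSupport site (H γ), h γ ^ 2)

/-- The Hamiltonian `∑ γ, s γ • H γ` for the choice `s` of signs. -/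
def hamiltonian {V : Type*} [NormedAddCommGroup V] [InnerProductSpace ℂ V]
    {Γ : Type*} [Fintype Γ] (H : Γ → V →L[ℂ] V) (s : Γ → ℤˣ) : V →L[ℂ] V :=
  ∑ γ, ((s γ : ℤ) : ℂ) • H γ

/-- The Lindblad operator `A + y [A, H]`. -/
def lindbladOp {V : Type*} [NormedAddCommGroup V] [InnerProductSpace ℂ V]
    (y : ℝ) (A H : V →L[ℂ] V) : V →L[ℂ] V :=
  A + (y : ℂ) • (A * H - H * A)

/-- The Heisenberg-picture superoperator `O ↦ K† O K - (1/2) {K† K, O}`. -/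
def dissipator {V : Type*} [NormedAddCommGroup V] [InnerProductSpace ℂ V] [CompleteSpace V]
    (K : V →L[ℂ] V) : (V →L[ℂ] V) →L[ℂ] (V →L[ℂ] V) :=
  ContinuousLinearMap.mulLeftRight ℂ (V →L[ℂ] V) (star K) K
    - (1 / 2 : ℂ) • (ContinuousLinearMap.mul ℂ (V →L[ℂ] V) (star K * K)
      + (ContinuousLinearMap.mul ℂ (V →L[ℂ] V)).flip (star K * K))

theorem dissipator_apply {V : Type*} [NormedAddCommGroup V] [InnerProductSpace ℂ V]
    [CompleteSpace V] (K O : V →L[ℂ] V) :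
    dissipator K O = star K * O * K - (1 / 2 : ℂ) • (star K * K * O + O * (star K * K)) := by
  simp [dissipator]

/-- The Heisenberg-picture Lindbladian for the choice `s` of signs. -/
def lindbladian {V : Type*} [NormedAddCommGroup V] [InnerProductSpace ℂ V] [CompleteSpace V]
    {Γ J : Type*} [Fintype Γ] [Fintype J] (H : Γ → V →L[ℂ] V) (A : J → V →L[ℂ] V) (y : ℝ)
    (s : Γ → ℤˣ) : (V →L[ℂ] V) →L[ℂ] (V →L[ℂ] V) :=
  ∑ a, dissipator (lindbladOp y (A a) (hamiltonian H s))

/-- The normalized trace `O ↦ Tr O / Tr I`. -/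
def normalizedTrace (V : Type*) [NormedAddCommGroup V] [InnerProductSpace ℂ V]
    [FiniteDimensional ℂ V] : (V →L[ℂ] V) →L[ℂ] ℂ :=
  LinearMap.toContinuousLinearMap
    ((Module.finrank ℂ V : ℂ)⁻¹ • (LinearMap.trace ℂ V ∘ₗ ContinuousLinearMap.coeLM ℂ))

theorem normalizedTrace_apply {V : Type*} [NormedAddCommGroup V] [InnerProductSpace ℂ V]
    [FiniteDimensional ℂ V] (O : V →L[ℂ] V) :
    normalizedTrace V O = LinearMap.trace ℂ V (O : V →ₗ[ℂ] V) / LinearMap.trace ℂ V 1 := by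
  simp [normalizedTrace, div_eq_inv_mul]

/-- The expectation over independent uniform signs `s : Γ → {1, -1}`. -/
def signExpectation {Γ : Type*} [Fintype Γ] [DecidableEq Γ] {E : Type*} [AddCommGroup E]
    [Module ℂ E] (f : (Γ → ℤˣ) → E) : E :=
  (Fintype.card (Γ → ℤˣ) : ℂ)⁻¹ • ∑ s : Γ → ℤˣ, f s

/-- The linear functional
`O ↦ 𝔼 [(∏ α ∈ U, s α) * Tr (∫ t₂ in 0..t, ∫ t₁ in 0..t₂, exp (t₁ • L†) O) / Tr I]`
on the operators on `V`. -/
def signedIntegral {V : Type*} [NormedAddCommGroup V] [InnerProductSpace ℂ V] [CompleteSpace V]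
    [FiniteDimensional ℂ V] {Γ J : Type*} [Fintype Γ] [DecidableEq Γ] [Fintype J]
    (H : Γ → V →L[ℂ] V) (A : J → V →L[ℂ] V) (y t : ℝ) (U : Finset Γ) : (V →L[ℂ] V) →L[ℂ] ℂ :=
  signExpectation fun s : Γ → ℤˣ =>
    (∏ α ∈ U, ((s α : ℤ) : ℂ)) •
      (normalizedTrace V).comp
        (∫ t₂ in (0 : ℝ)..t, ∫ t₁ in (0 : ℝ)..t₂,
          NormedSpace.exp ((t₁ : ℂ) • lindbladian H A y s))

end RandomLindblad

end

/-!
The signs act by multiplication on the functions of the signs, so that averaging over them is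
taking the expectation in the uniform vector `1`. Call the mode `γ` occupied in a function that is
odd in `s γ`. Then `1` is the vacuum, and the Lindbladian becomes that of the jumps
`A a (1 + 2 ∑ γ, b a γ X γ)`, where `X γ = s γ • y • H γ` toggles the mode `γ` and has norm at most
`w γ = |y| h γ`.

On the projection `p B` onto the states in which all modes of `B` are occupied, the generator is
the sum of the double commutators `-2 [G a, [G a, p B]]` with `G a = ∑ γ, b a γ X γ`, because the
isometries `A a` commute with `p B` and drop out. A mode in `B` brings a factor `w γ` and removes
`γ` from `B`. Since the `X γ` pairwise commute or anticommute, the modes outside `B` enter only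
through the quadratic weight `∑ γ, b a γ w γ²`, which the hypothesis on `y` makes at most `1 / 8`.
By induction on `m = |B|` and Grönwall's inequality, all modes of `B` are occupied with probability
at most `C m * ∏ γ ∈ B, w γ²` up to time `t`, as `aloc k t < 1`.

Finally `(∏ α ∈ U, s α) O` toggles all modes of `U`, so by Cauchy–Schwarz its expectation in the
evolved vacuum is at most a constant times `‖O‖ ∏ α ∈ U, w α`.
-/

namespace RandomLindblad

open NormedSpace Filter Topology
open scoped ComplexOrder

attribute [local instance] LieRing.ofAssociativeRing

section PositiveFunctional

variable {𝓑 : Type*} [CStarAlgebra 𝓑] [PartialOrder 𝓑] [StarOrderedRing 𝓑] (ω : 𝓑 →ₚ[ℂ] ℂ)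

/-- The seminorm `√ω(x* x)` of a positive functional `ω`, taken from the GNS construction. -/
noncomputable abbrev twoNorm (x : 𝓑) : ℝ := ‖ω.toPreGNS x‖

theorem twoNorm_sq (x : 𝓑) : twoNorm ω x ^ 2 = (ω (star x * x)).re := by
  exact_mod_cast congrArg Complex.re (ω.preGNS_norm_sq (ω.toPreGNS x))

theorem norm_apply_star_mul_le (x y : 𝓑) :
    ‖ω (star x * y)‖ ≤ twoNorm ω x * twoNorm ω y :=
  norm_inner_le_norm (𝕜 := ℂ) (ω.toPreGNS x) (ω.toPreGNS y)

theorem norm_apply_star (x : 𝓑) : ‖ω (star x)‖ = ‖ω x‖ := by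
  rw [map_star, norm_star]

theorem twoNorm_mul_le (x y : 𝓑) : twoNorm ω (x * y) ≤ ‖x‖ * twoNorm ω y :=
  (ω.leftMulMapPreGNS x).le_of_opNorm_le
    (LinearMap.mkContinuous_norm_le _ (norm_nonneg x) _) (ω.toPreGNS y)

theorem twoNorm_add_le (x y : 𝓑) : twoNorm ω (x + y) ≤ twoNorm ω x + twoNorm ω y := by
  simpa only [twoNorm, map_add] using norm_add_le (ω.toPreGNS x) (ω.toPreGNS y)

theorem twoNorm_sum_smul_le {ι : Type*} (s : Finset ι) (c : ι → ℝ) (hc : ∀ i, 0 ≤ c i)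
    (x : ι → 𝓑) :
    twoNorm ω (∑ i ∈ s, (c i : ℂ) • x i) ≤ ∑ i ∈ s, c i * twoNorm ω (x i) := by
  simp only [twoNorm, map_sum, map_smul]
  refine (norm_sum_le _ _).trans_eq (Finset.sum_congr rfl fun i _ => ?_)
  rw [norm_smul, Complex.norm_of_nonneg (hc i)]

theorem twoNorm_sum_sq_le {ι : Type*} (s : Finset ι) (x : ι → 𝓑) :
    twoNorm ω (∑ i ∈ s, x i) ^ 2 ≤ ∑ i ∈ s, ∑ j ∈ s, ‖ω (star (x i) * x j)‖ := by
  rw [twoNorm_sq, star_sum, Finset.sum_mul_sum, map_sum]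
  simp only [map_sum]
  exact (Complex.re_le_norm _).trans ((norm_sum_le _ _).trans
    (Finset.sum_le_sum fun i _ => norm_sum_le _ _))

theorem twoNorm_sum_le_of_almost_orthogonal {ι : Type*} {s : Finset ι} {x : ι → 𝓑} {a d : ι → ℝ}
    (hd : ∀ i ∈ s, 0 ≤ d i) (hdiag : ∀ i ∈ s, twoNorm ω (x i) ≤ a i)
    (hoff : ∀ i ∈ s, ∀ j ∈ s, i ≠ j → ‖ω (star (x i) * x j)‖ ≤ d i * d j) :
    twoNorm ω (∑ i ∈ s, x i) ≤ √(∑ i ∈ s, a i ^ 2) + ∑ i ∈ s, d i := by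
  classical
  have hentry : ∀ i ∈ s, ∀ j ∈ s,
      ‖ω (star (x i) * x j)‖ ≤ (if i = j then a i ^ 2 else 0) + d i * d j := by
    intro i hi j hj
    split_ifs with h
    · subst h
      have := (norm_apply_star_mul_le ω (x i) (x i)).trans
        (mul_self_le_mul_self (norm_nonneg _) (hdiag i hi))
      linarith [mul_self_nonneg (d i)]
    · simpa using hoff i hi j hj h
  have hsq : twoNorm ω (∑ i ∈ s, x i) ^ 2 ≤ ∑ i ∈ s, a i ^ 2 + (∑ i ∈ s, d i) ^ 2 := by
    refine (twoNorm_sum_sq_le ω s x).trans ((Finset.sum_le_sum fun i hi =>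
      Finset.sum_le_sum (hentry i hi)).trans_eq ?_)
    simp [Finset.sum_add_distrib, sq (∑ i ∈ s, d i), Finset.sum_mul_sum]
  have hA : 0 ≤ ∑ i ∈ s, a i ^ 2 := Finset.sum_nonneg fun i _ => sq_nonneg _
  have hD : 0 ≤ ∑ i ∈ s, d i := Finset.sum_nonneg hd
  refine le_of_sq_le_sq ?_ (by positivity)
  nlinarith [Real.sq_sqrt hA, mul_nonneg (Real.sqrt_nonneg (∑ i ∈ s, a i ^ 2)) hD]

theorem norm_apply_lie_le {x p : 𝓑} (hx : star x = -x) (hp : IsSelfAdjoint p) :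
    ‖ω ⁅x, p⁆‖ ≤ 2 * ‖ω (x * p)‖ := by
  have hstar : star (x * p) = -(p * x) := by rw [star_mul, hp.star_eq, hx, mul_neg]
  have hlie : ⁅x, p⁆ = x * p + star (x * p) := by
    rw [hstar, Ring.lie_def, sub_eq_add_neg]
  calc ‖ω ⁅x, p⁆‖ ≤ ‖ω (x * p)‖ + ‖ω (star (x * p))‖ := by
        rw [hlie, map_add]; exact norm_add_le _ _
    _ = 2 * ‖ω (x * p)‖ := by rw [norm_apply_star]; ring

end PositiveFunctional

section ModeProjections

variable {𝓑 : Type*} [CStarAlgebra 𝓑] {Γ : Type*} [DecidableEq Γ] {p : Finset Γ → 𝓑}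

/-- A Boolean family of commuting projections: `p B` says that every mode in `B` is occupied. -/
structure ModeProjections (p : Finset Γ → 𝓑) : Prop where
  empty : p ∅ = 1
  isStarProjection : ∀ B, IsStarProjection (p B)
  mul : ∀ B C, p B * p C = p (B ∪ C)

namespace ModeProjections

variable (hp : ModeProjections p)
include hp

theorem star_eq (B : Finset Γ) : star (p B) = p B := (hp.isStarProjection B).isSelfAdjoint

theorem mul_self (B : Finset Γ) : p B * p B = p B := (hp.isStarProjection B).isIdempotentElem

theorem mul_of_subset {B C : Finset Γ} (h : B ⊆ C) : p B * p C = p C := by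
  rw [hp.mul, Finset.union_eq_right.2 h]

theorem mul_of_superset {B C : Finset Γ} (h : C ⊆ B) : p B * p C = p B := by
  rw [hp.mul, Finset.union_eq_left.2 h]

theorem mul_comm (B C : Finset Γ) : p B * p C = p C * p B := by
  rw [hp.mul, hp.mul, Finset.union_comm]

variable [PartialOrder 𝓑] [StarOrderedRing 𝓑] (ω : 𝓑 →ₚ[ℂ] ℂ)

theorem twoNorm_sq (B : Finset Γ) : twoNorm ω (p B) ^ 2 = (ω (p B)).re := by
  rw [RandomLindblad.twoNorm_sq, hp.star_eq, hp.mul_self]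

theorem twoNorm_mul_le (B : Finset Γ) (x : 𝓑) : twoNorm ω (p B * x) ≤ twoNorm ω x :=
  (RandomLindblad.twoNorm_mul_le ω (p B) x).trans
    (mul_le_of_le_one_left (norm_nonneg _) (hp.isStarProjection B).norm_le)

theorem twoNorm_anti {B C : Finset Γ} (h : B ⊆ C) : twoNorm ω (p C) ≤ twoNorm ω (p B) := by
  simpa only [hp.mul_of_superset h] using hp.twoNorm_mul_le ω C (p B)

end ModeProjections

end ModeProjections

section ModeSystem

variable {𝓑 : Type*} [CStarAlgebra 𝓑] {Γ : Type*} [DecidableEq Γ]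
  {X : Γ → 𝓑} {w : Γ → ℝ} {p : Finset Γ → 𝓑}

/-- Terms `X γ` of norm at most `w γ`, pairwise commuting or anticommuting, such that `X γ` toggles
the occupation of the mode `γ` and leaves all other modes alone. -/
structure ModeSystem (X : Γ → 𝓑) (w : Γ → ℝ) (p : Finset Γ → 𝓑) : Prop
    extends ModeProjections p where
  isSelfAdjoint : ∀ γ, IsSelfAdjoint (X γ)
  norm_le : ∀ γ, ‖X γ‖ ≤ w γ
  commute_or_anticommute : ∀ γ δ, Commute (X γ) (X δ) ∨ X γ * X δ = -(X δ * X γ)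
  commute : ∀ {γ B}, γ ∉ B → Commute (X γ) (p B)
  toggle : ∀ γ, X γ * p {γ} = (1 - p {γ}) * X γ

namespace ModeSystem

variable (hX : ModeSystem X w p)
include hX

theorem weight_nonneg (γ : Γ) : 0 ≤ w γ := (norm_nonneg _).trans (hX.norm_le γ)

theorem term_mul_proj_add {γ : Γ} {C : Finset Γ} (hγ : γ ∉ C) :
    X γ * p C = X γ * p (insert γ C) + p (insert γ C) * X γ := by
  have hC : X γ * p C = p C * X γ := hX.commute hγ
  rw [Finset.insert_eq, ← hX.mul, ← mul_assoc, hX.toggle, mul_assoc (p {γ}), ← hC]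
  noncomm_ring

theorem proj_mul_term (B : Finset Γ) (γ : Γ) : p B * X γ = p B * X γ * p (B.erase γ) := by
  rw [mul_assoc, (hX.commute (B.notMem_erase γ)).eq, ← mul_assoc,
    hX.mul_of_superset (B.erase_subset γ)]

theorem lie_proj_eq_zero {γ : Γ} {B : Finset Γ} (hγ : γ ∉ B) : ⁅X γ, p B⁆ = 0 := by
  rw [Ring.lie_def, (hX.commute hγ).eq, sub_self]

theorem exists_lie_eq_smul_mul (γ δ : Γ) :
    ∃ e : ℝ, 0 ≤ e ∧ e ≤ 2 ∧ ⁅X γ, X δ⁆ = (e : ℂ) • (X γ * X δ) := by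
  rcases hX.commute_or_anticommute γ δ with h | h
  · exact ⟨0, le_rfl, zero_le_two, by rw [Ring.lie_def, h.eq]; simp⟩
  · refine ⟨2, zero_le_two, le_rfl, ?_⟩
    rw [Ring.lie_def, sub_eq_add_neg, ← h, Complex.ofReal_ofNat, two_smul]

variable [PartialOrder 𝓑] [StarOrderedRing 𝓑] (ω : 𝓑 →ₚ[ℂ] ℂ)

theorem twoNorm_term_mul_le (γ : Γ) (x : 𝓑) : twoNorm ω (X γ * x) ≤ w γ * twoNorm ω x :=
  (twoNorm_mul_le ω (X γ) x).trans (by gcongr; exact hX.norm_le γ)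

theorem twoNorm_proj_mul_term_le (B : Finset Γ) (γ : Γ) :
    twoNorm ω (p B * X γ) ≤ w γ * twoNorm ω (p (B.erase γ)) := by
  rw [hX.proj_mul_term, mul_assoc]
  exact (hX.twoNorm_mul_le ω B _).trans (hX.twoNorm_term_mul_le ω γ _)

theorem norm_apply_term_proj_proj_term_le {γ δ : Γ} {C : Finset Γ}
    (hγ : γ ∉ C) (hδ : δ ∉ C) (hγδ : γ ≠ δ) :
    ‖ω (star (p (insert γ C) * X γ) * (p (insert δ C) * X δ))‖
      ≤ w γ * twoNorm ω (p (insert γ C)) * (w δ * twoNorm ω (p (insert δ C))) := by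
  have hswap : star (p (insert γ C) * X γ) * (p (insert δ C) * X δ)
      = star (X γ * p (insert δ C)) * (X δ * p (insert γ C)) := by
    have hγ' : X γ * p (insert δ C) = p (insert δ C) * X γ := hX.commute (by simp [hγ, hγδ])
    have hδ' : X δ * p (insert γ C) = p (insert γ C) * X δ := hX.commute (by simp [hδ, hγδ.symm])
    rw [star_mul, star_mul, hX.star_eq, hX.star_eq, (hX.isSelfAdjoint γ).star_eq, hδ',
      ← hγ', mul_assoc, mul_assoc, ← mul_assoc (p (insert γ C)), hX.mul_comm, mul_assoc]
  rw [hswap]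
  calc _ ≤ twoNorm ω (X γ * p (insert δ C)) * twoNorm ω (X δ * p (insert γ C)) :=
        norm_apply_star_mul_le ω _ _
    _ ≤ w γ * twoNorm ω (p (insert δ C)) * (w δ * twoNorm ω (p (insert γ C))) := by
        have := hX.weight_nonneg γ
        gcongr <;> exact hX.twoNorm_term_mul_le ω _ _
    _ = _ := by ring

theorem twoNorm_sum_proj_mul_term_le {s C : Finset Γ} (hs : Disjoint s C) {v : Γ → ℝ}
    (hv : ∀ γ, 0 ≤ v γ) :
    twoNorm ω (∑ γ ∈ s, (v γ : ℂ) • (p (insert γ C) * X γ))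
      ≤ √(∑ γ ∈ s, (v γ * (w γ * twoNorm ω (p C))) ^ 2)
        + ∑ γ ∈ s, v γ * (w γ * twoNorm ω (p (insert γ C))) := by
  have hw := hX.weight_nonneg
  refine twoNorm_sum_le_of_almost_orthogonal ω
    (fun γ _ => mul_nonneg (hv γ) (mul_nonneg (hw γ) (norm_nonneg _))) ?_ ?_
  · intro γ hγ
    rw [twoNorm, map_smul, norm_smul, Complex.norm_of_nonneg (hv γ)]
    refine mul_le_mul_of_nonneg_left ?_ (hv γ)
    simpa [Finset.disjoint_left.1 hs hγ] using hX.twoNorm_proj_mul_term_le ω (insert γ C) γ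
  · intro γ hγ δ hδ hγδ
    rw [star_smul, smul_mul_smul_comm, map_smul, norm_smul, norm_mul, norm_star,
      Complex.norm_of_nonneg (hv γ), Complex.norm_of_nonneg (hv δ), mul_mul_mul_comm]
    exact mul_le_mul_of_nonneg_left (hX.norm_apply_term_proj_proj_term_le ω
      (Finset.disjoint_left.1 hs hγ) (Finset.disjoint_left.1 hs hδ) hγδ)
      (mul_nonneg (hv γ) (hv δ))

theorem twoNorm_sum_term_mul_proj_le {s C : Finset Γ} (hs : Disjoint s C) {v : Γ → ℝ}
    (hv : ∀ γ, 0 ≤ v γ) :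
    twoNorm ω ((∑ γ ∈ s, (v γ : ℂ) • X γ) * p C)
      ≤ √(∑ γ ∈ s, (v γ * (w γ * twoNorm ω (p C))) ^ 2)
        + 2 * ∑ γ ∈ s, v γ * (w γ * twoNorm ω (p (insert γ C))) := by
  have hsplit : (∑ γ ∈ s, (v γ : ℂ) • X γ) * p C
      = ∑ γ ∈ s, (v γ : ℂ) • (X γ * p (insert γ C))
        + ∑ γ ∈ s, (v γ : ℂ) • (p (insert γ C) * X γ) := by
    rw [Finset.sum_mul, ← Finset.sum_add_distrib]
    refine Finset.sum_congr rfl fun γ hγ => ?_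
    rw [smul_mul_assoc, hX.term_mul_proj_add (Finset.disjoint_left.1 hs hγ), smul_add]
  have hleft : twoNorm ω (∑ γ ∈ s, (v γ : ℂ) • (X γ * p (insert γ C)))
      ≤ ∑ γ ∈ s, v γ * (w γ * twoNorm ω (p (insert γ C))) :=
    (twoNorm_sum_smul_le ω s v hv _).trans (Finset.sum_le_sum fun γ _ =>
      mul_le_mul_of_nonneg_left (hX.twoNorm_term_mul_le ω γ _) (hv γ))
  rw [hsplit]
  linarith [twoNorm_add_le ω (∑ γ ∈ s, (v γ : ℂ) • (X γ * p (insert γ C)))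
    (∑ γ ∈ s, (v γ : ℂ) • (p (insert γ C) * X γ)), hX.twoNorm_sum_proj_mul_term_le ω hs hv]

end ModeSystem

end ModeSystem

theorem sqrt_sum_mul_mul_sq_le {ι : Type*} {s : Finset ι} {v w : ι → ℝ} (hv₀ : ∀ i, 0 ≤ v i)
    (hv₂ : ∀ i, v i ≤ 2) (hv : ∑ i ∈ s, v i * w i ^ 2 ≤ 1 / 4) {x : ℝ} (hx : 0 ≤ x) :
    √(∑ i ∈ s, (v i * (w i * x)) ^ 2) ≤ x := by
  refine Real.sqrt_le_iff.2 ⟨hx, ?_⟩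
  calc ∑ i ∈ s, (v i * (w i * x)) ^ 2 ≤ ∑ i ∈ s, 2 * (v i * w i ^ 2) * x ^ 2 := by
        refine Finset.sum_le_sum fun i _ => ?_
        nlinarith [mul_nonneg (mul_nonneg (hv₀ i) (sub_nonneg.2 (hv₂ i))) (sq_nonneg (w i * x))]
    _ = 2 * (∑ i ∈ s, v i * w i ^ 2) * x ^ 2 := by rw [Finset.mul_sum, Finset.sum_mul]
    _ ≤ x ^ 2 := by nlinarith [sq_nonneg x]

section ModeBounds

variable {𝓑 : Type*} [CStarAlgebra 𝓑] [PartialOrder 𝓑] [StarOrderedRing 𝓑]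
  {Γ : Type*} [DecidableEq Γ] {ω : 𝓑 →ₚ[ℂ] ℂ} {X : Γ → 𝓑} {w : Γ → ℝ} {p : Finset Γ → 𝓑}
  {m : ℕ} {q r : ℝ}

/-- Occupation bounds relative to the product of the weights: `q` for fewer than `m` modes and `r`
for exactly `m` modes.  Along the evolution `q` is known from the previous induction step and `r` is
the quantity that obeys a Grönwall inequality. -/
structure ModeBounds (ω : 𝓑 →ₚ[ℂ] ℂ) (w : Γ → ℝ) (p : Finset Γ → 𝓑) (m : ℕ) (q r : ℝ) :
    Prop where
  left_nonneg : 0 ≤ q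
  right_nonneg : 0 ≤ r
  le_of_card_lt : ∀ B, B.card < m → twoNorm ω (p B) ≤ q * ∏ γ ∈ B, w γ
  le_of_card_eq : ∀ B, B.card = m → twoNorm ω (p B) ≤ r * ∏ γ ∈ B, w γ

namespace ModeSystem

variable (hX : ModeSystem X w p) (hb : ModeBounds ω w p m q r)
include hX hb

theorem weight_mul_twoNorm_erase_le {B : Finset Γ} (hB : B.card = m) {β : Γ} (hβ : β ∈ B) :
    w β * twoNorm ω (p (B.erase β)) ≤ q * ∏ γ ∈ B, w γ := by
  have hcard : (B.erase β).card < m := hB ▸ Finset.card_erase_lt_of_mem hβ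
  calc w β * twoNorm ω (p (B.erase β)) ≤ w β * (q * ∏ γ ∈ B.erase β, w γ) :=
        mul_le_mul_of_nonneg_left (hb.le_of_card_lt _ hcard) (hX.weight_nonneg β)
    _ = q * ∏ γ ∈ B, w γ := by rw [← Finset.mul_prod_erase B w hβ]; ring

theorem norm_apply_term_proj_term_le {B : Finset Γ} (hB : B.card = m) {γ β : Γ} (hγ : γ ∈ B)
    (hβ : β ∈ B) : ‖ω (X γ * p B * X β)‖ ≤ (q * ∏ i ∈ B, w i) ^ 2 := by
  have hfactor : X γ * p B * X β = star (p B * X γ) * (p B * X β) := by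
    rw [star_mul, hX.star_eq, (hX.isSelfAdjoint γ).star_eq, ← mul_assoc,
      mul_assoc (X γ) (p B) (p B), hX.mul_self]
  have hside : ∀ δ ∈ B, twoNorm ω (p B * X δ) ≤ q * ∏ i ∈ B, w i := fun δ hδ =>
    (hX.twoNorm_proj_mul_term_le ω B δ).trans (hX.weight_mul_twoNorm_erase_le hb hB hδ)
  rw [hfactor, sq]
  exact (norm_apply_star_mul_le ω _ _).trans
    (mul_le_mul (hside γ hγ) (hside β hβ) (norm_nonneg _) ((norm_nonneg _).trans (hside γ hγ)))

omit hb in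
theorem norm_apply_term_term_proj_le_of_subset (ω : 𝓑 →ₚ[ℂ] ℂ) {D B : Finset Γ} (hDB : D ⊆ B)
    {γ β : Γ} (hγ : γ ∉ D) (hβ : β ∉ D) :
    ‖ω (X γ * X β * p B)‖ ≤ w γ * twoNorm ω (p D) * (w β * twoNorm ω (p B)) := by
  have hfactor : X γ * X β * p B = star (X γ * p D) * (X β * p B) := by
    rw [star_mul, hX.star_eq, (hX.isSelfAdjoint γ).star_eq, ← (hX.commute hγ).eq,
      mul_assoc (X γ) (p D), ← mul_assoc (p D), ← (hX.commute hβ).eq, mul_assoc (X β),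
      hX.mul_of_subset hDB, ← mul_assoc]
  rw [hfactor]
  exact (norm_apply_star_mul_le ω _ _).trans (mul_le_mul (hX.twoNorm_term_mul_le ω γ _)
    (hX.twoNorm_term_mul_le ω β _) (norm_nonneg _)
    (mul_nonneg (hX.weight_nonneg γ) (norm_nonneg _)))

theorem norm_apply_term_term_proj_le {B : Finset Γ} (hB : B.card = m) {γ β : Γ} (hγ : γ ∈ B)
    (hβ : β ∈ B) : ‖ω (X γ * X β * p B)‖ ≤ (q * r + q ^ 2) * (∏ i ∈ B, w i) ^ 2 := by
  have hq0 := hb.left_nonneg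
  have hr0 := hb.right_nonneg
  have hw := hX.weight_nonneg
  have hW : ∀ C : Finset Γ, 0 ≤ ∏ i ∈ C, w i := fun C => Finset.prod_nonneg fun i _ => hw i
  rcases eq_or_ne β γ with rfl | hne
  · have herase := hX.weight_mul_twoNorm_erase_le hb hB hβ
    have hproj : w β * twoNorm ω (p B) ≤ q * ∏ i ∈ B, w i := le_trans
      (mul_le_mul_of_nonneg_left (hX.twoNorm_anti ω (Finset.erase_subset β B)) (hw β)) herase
    calc _ ≤ w β * twoNorm ω (p (B.erase β)) * (w β * twoNorm ω (p B)) :=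
          hX.norm_apply_term_term_proj_le_of_subset ω (Finset.erase_subset β B)
            (Finset.notMem_erase β B) (Finset.notMem_erase β B)
      _ ≤ q * (∏ i ∈ B, w i) * (q * ∏ i ∈ B, w i) :=
          mul_le_mul herase hproj (mul_nonneg (hw β) (norm_nonneg _)) (mul_nonneg hq0 (hW B))
      _ ≤ _ := by nlinarith [mul_nonneg (mul_nonneg hq0 hr0) (sq_nonneg (∏ i ∈ B, w i))]
  · set D := (B.erase γ).erase β
    have hβ' : β ∈ B.erase γ := Finset.mem_erase.2 ⟨hne, hβ⟩
    have hcard : D.card < m := (Finset.card_erase_lt_of_mem hβ').trans_le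
      (hB ▸ Finset.card_le_card (Finset.erase_subset γ B))
    have hprod : ∏ i ∈ B, w i = w γ * (w β * ∏ i ∈ D, w i) := by
      rw [Finset.mul_prod_erase _ w hβ', Finset.mul_prod_erase _ w hγ]
    have := hw γ
    have := hw β
    have := hW D
    calc _ ≤ w γ * twoNorm ω (p D) * (w β * twoNorm ω (p B)) :=
          hX.norm_apply_term_term_proj_le_of_subset ω
            ((Finset.erase_subset _ _).trans (Finset.erase_subset _ _))
            (fun h => Finset.notMem_erase γ B (Finset.mem_of_mem_erase h))
            (Finset.notMem_erase β _)
      _ ≤ w γ * (q * ∏ i ∈ D, w i) * (w β * (r * ∏ i ∈ B, w i)) := by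
          gcongr
          exacts [hb.le_of_card_lt D hcard, hb.le_of_card_eq B hB]
      _ = q * r * (∏ i ∈ B, w i) ^ 2 := by rw [hprod]; ring
      _ ≤ _ := by nlinarith [sq_nonneg (q * ∏ i ∈ B, w i)]

theorem norm_apply_lie_lie_term_le {B : Finset Γ} (hB : B.card = m) {γ β : Γ} (hγ : γ ∈ B)
    (hβ : β ∈ B) :
    ‖ω ⁅X γ, ⁅X β, p B⁆⁆‖ ≤ (2 * (q * r) + 4 * q ^ 2) * (∏ i ∈ B, w i) ^ 2 := by
  have hstar : star (X γ * X β * p B) = p B * X β * X γ := by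
    simp only [star_mul, hX.star_eq, (hX.isSelfAdjoint _).star_eq, mul_assoc]
  have hlie : ω ⁅X γ, ⁅X β, p B⁆⁆ = ω (X γ * X β * p B) + ω (star (X γ * X β * p B))
      - (ω (X γ * p B * X β) + ω (X β * p B * X γ)) := by
    rw [hstar, ← map_add, ← map_add, ← map_sub]
    congr 1
    simp only [Ring.lie_def]
    noncomm_ring
  have h₁ := hX.norm_apply_term_term_proj_le hb hB hγ hβ
  have h₂ := hX.norm_apply_term_proj_term_le hb hB hγ hβ
  have h₃ := hX.norm_apply_term_proj_term_le hb hB hβ hγ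
  have htri := norm_sub_le (ω (X γ * X β * p B) + ω (star (X γ * X β * p B)))
    (ω (X γ * p B * X β) + ω (X β * p B * X γ))
  have hleft := norm_add_le (ω (X γ * X β * p B)) (ω (star (X γ * X β * p B)))
  have hright := norm_add_le (ω (X γ * p B * X β)) (ω (X β * p B * X γ))
  rw [norm_apply_star] at hleft
  rw [hlie]
  linarith

theorem twoNorm_sum_term_mul_proj_le_of_card {C : Finset Γ} (hC : C.card + 1 = m)
    {s : Finset Γ} (hs : Disjoint s C) {v : Γ → ℝ} (hv₀ : ∀ γ, 0 ≤ v γ) (hv₂ : ∀ γ, v γ ≤ 2)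
    (hv : ∑ γ ∈ s, v γ * w γ ^ 2 ≤ 1 / 4) :
    twoNorm ω ((∑ γ ∈ s, (v γ : ℂ) • X γ) * p C) ≤ (q + r / 2) * ∏ i ∈ C, w i := by
  set W := ∏ i ∈ C, w i
  have hlow : twoNorm ω (p C) ≤ q * W := hb.le_of_card_lt C (by omega)
  have hhigh : ∀ γ ∈ s, twoNorm ω (p (insert γ C)) ≤ r * (w γ * W) := by
    intro γ hγ
    have hγC := Finset.disjoint_left.1 hs hγ
    rw [← Finset.prod_insert hγC]
    exact hb.le_of_card_eq _ ((Finset.card_insert_of_notMem hγC).trans hC)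
  have hoff : ∑ γ ∈ s, v γ * (w γ * twoNorm ω (p (insert γ C))) ≤ r * W / 4 := by
    calc _ ≤ ∑ γ ∈ s, v γ * w γ ^ 2 * (r * W) := by
          refine Finset.sum_le_sum fun γ hγ => ?_
          nlinarith [mul_le_mul_of_nonneg_left (hhigh γ hγ)
            (mul_nonneg (hv₀ γ) (hX.weight_nonneg γ))]
      _ = (∑ γ ∈ s, v γ * w γ ^ 2) * (r * W) := by rw [Finset.sum_mul]
      _ ≤ r * W / 4 := by
          nlinarith [mul_nonneg hb.right_nonneg
            (Finset.prod_nonneg fun i (_ : i ∈ C) => hX.weight_nonneg i)]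
  linarith [hX.twoNorm_sum_term_mul_proj_le ω hs hv₀,
    sqrt_sum_mul_mul_sq_le hv₀ hv₂ hv (norm_nonneg (ω.toPreGNS (p C)))]

theorem norm_apply_sum_term_mul_term_mul_proj_le {B : Finset Γ} (hB : B.card = m) {β : Γ}
    (hβ : β ∈ B) {s : Finset Γ} (hs : Disjoint s B) {v : Γ → ℝ} (hv₀ : ∀ γ, 0 ≤ v γ)
    (hv₂ : ∀ γ, v γ ≤ 2) (hv : ∑ γ ∈ s, v γ * w γ ^ 2 ≤ 1 / 4) :
    ‖ω ((∑ γ ∈ s, (v γ : ℂ) • X γ) * X β * p B)‖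
      ≤ (q * r + r ^ 2 / 2) * (∏ i ∈ B, w i) ^ 2 := by
  set Y := ∑ γ ∈ s, (v γ : ℂ) • X γ
  set C := B.erase β
  have hY : star Y = Y := by
    simp [Y, star_sum, (hX.isSelfAdjoint _).star_eq]
  have hYC : Commute Y (p C) := Commute.sum_left _ _ _ fun γ hγ =>
    (hX.commute fun h => Finset.disjoint_left.1 hs hγ (Finset.mem_of_mem_erase h)).smul_left _
  have hfactor : Y * X β * p B = star (Y * p C) * (X β * p B) := by
    rw [star_mul, hX.star_eq, hY, ← hYC.eq, mul_assoc Y (p C), ← mul_assoc (p C),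
      ← (hX.commute (Finset.notMem_erase β B)).eq, mul_assoc (X β),
      hX.mul_of_subset (Finset.erase_subset β B), ← mul_assoc]
  have hleft := hX.twoNorm_sum_term_mul_proj_le_of_card hb
    ((Finset.card_erase_add_one hβ).trans hB)
    (hs.mono_right (Finset.erase_subset β B)) hv₀ hv₂ hv
  have hright : twoNorm ω (X β * p B) ≤ w β * (r * ∏ i ∈ B, w i) :=
    (hX.twoNorm_term_mul_le ω β _).trans
      (mul_le_mul_of_nonneg_left (hb.le_of_card_eq B hB) (hX.weight_nonneg β))
  rw [hfactor]
  calc _ ≤ (q + r / 2) * (∏ i ∈ C, w i) * (w β * (r * ∏ i ∈ B, w i)) :=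
        (norm_apply_star_mul_le ω _ _).trans (mul_le_mul hleft hright (norm_nonneg _)
          ((norm_nonneg _).trans hleft))
    _ = _ := by rw [← Finset.mul_prod_erase B w hβ]; ring

theorem norm_apply_lie_lie_sum_outside_le {B : Finset Γ} (hB : B.card = m) {β : Γ} (hβ : β ∈ B)
    {s : Finset Γ} (hs : Disjoint s B) {c : Γ → ℝ} (hc₀ : ∀ γ, 0 ≤ c γ) (hc₁ : ∀ γ, c γ ≤ 1)
    (hc : ∑ γ ∈ s, c γ * w γ ^ 2 ≤ 1 / 8) :
    ‖ω ⁅∑ γ ∈ s, (c γ : ℂ) • X γ, ⁅X β, p B⁆⁆‖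
      ≤ (2 * (q * r) + r ^ 2) * (∏ i ∈ B, w i) ^ 2 := by
  set Z := ⁅∑ γ ∈ s, (c γ : ℂ) • X γ, X β⁆
  have hZstar : star Z = -Z := by
    simp [Z, Ring.lie_def, star_sum, (hX.isSelfAdjoint _).star_eq]
  have hjacobi : ⁅∑ γ ∈ s, (c γ : ℂ) • X γ, ⁅X β, p B⁆⁆ = ⁅Z, p B⁆ := by
    have hcomm : ⁅∑ γ ∈ s, (c γ : ℂ) • X γ, p B⁆ = 0 := by
      rw [← commute_iff_lie_eq]
      exact Commute.sum_left _ _ _ fun γ hγ =>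
        (hX.commute (Finset.disjoint_left.1 hs hγ)).smul_left _
    rw [leibniz_lie, hcomm, lie_zero, add_zero]
  choose e he₀ he₂ he using fun γ => hX.exists_lie_eq_smul_mul γ β
  have hZ : Z = (∑ γ ∈ s, ((c γ * e γ : ℝ) : ℂ) • X γ) * X β := by
    simp only [Z, Ring.lie_def, Finset.sum_mul, Finset.mul_sum, ← Finset.sum_sub_distrib]
    refine Finset.sum_congr rfl fun γ _ => ?_
    rw [smul_mul_assoc, mul_smul_comm, ← smul_sub, ← Ring.lie_def, he, smul_smul, smul_mul_assoc,
      Complex.ofReal_mul]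
  have hce : ∑ γ ∈ s, c γ * e γ * w γ ^ 2 ≤ 1 / 4 := by
    calc _ ≤ ∑ γ ∈ s, 2 * (c γ * w γ ^ 2) := Finset.sum_le_sum fun γ _ => by
          nlinarith [mul_nonneg (mul_nonneg (hc₀ γ) (sub_nonneg.2 (he₂ γ))) (sq_nonneg (w γ))]
      _ ≤ 1 / 4 := by rw [← Finset.mul_sum]; linarith
  have hbound := hX.norm_apply_sum_term_mul_term_mul_proj_le hb hB hβ hs
    (fun γ => mul_nonneg (hc₀ γ) (he₀ γ))
    (fun γ => (mul_le_mul (hc₁ γ) (he₂ γ) (he₀ γ) zero_le_one).trans_eq (one_mul 2)) hce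
  rw [← hZ] at hbound
  rw [hjacobi]
  linarith [norm_apply_lie_le ω hZstar (hX.isStarProjection B).isSelfAdjoint]

end ModeSystem

end ModeBounds

section WeakCoupling

variable {𝓑 : Type*} [CStarAlgebra 𝓑] {Γ J : Type*} [Fintype Γ]

/-- The combination `∑ γ, c γ • X γ` of the terms through which a jump acts on the modes. -/
noncomputable def couplingSum (X : Γ → 𝓑) (c : Γ → ℝ) : 𝓑 := ∑ γ, (c γ : ℂ) • X γ

/-- Couplings `c a γ` in `[0, 1]` of the jumps to the modes, weak in the sense that each jump has
quadratic weight at most `1 / 8`, while the couplings of all jumps to one mode add up to at most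
`l`. -/
structure WeakCoupling [Fintype J] (c : J → Γ → ℝ) (w : Γ → ℝ) (l : ℝ) : Prop where
  nonneg : ∀ a γ, 0 ≤ c a γ
  le_one : ∀ a γ, c a γ ≤ 1
  sum_mul_sq_le : ∀ a, ∑ γ, c a γ * w γ ^ 2 ≤ 1 / 8
  sum_le : ∀ γ, ∑ a, c a γ ≤ l
  rate_nonneg : 0 ≤ l

namespace ModeSystem

variable [DecidableEq Γ] {X : Γ → 𝓑} {w : Γ → ℝ} {p : Finset Γ → 𝓑} (hX : ModeSystem X w p)
include hX

theorem isSelfAdjoint_couplingSum (c : Γ → ℝ) : IsSelfAdjoint (couplingSum X c) := by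
  simp [IsSelfAdjoint, couplingSum, star_sum, (hX.isSelfAdjoint _).star_eq]

theorem lie_couplingSum_proj (c : Γ → ℝ) (B : Finset Γ) :
    ⁅couplingSum X c, p B⁆ = ∑ β ∈ B, (c β : ℂ) • ⁅X β, p B⁆ := by
  simp only [couplingSum, sum_lie, smul_lie]
  refine (Finset.sum_subset (Finset.subset_univ B) fun γ _ hγ => ?_).symm
  rw [hX.lie_proj_eq_zero hγ, smul_zero]

variable [PartialOrder 𝓑] [StarOrderedRing 𝓑] {ω : 𝓑 →ₚ[ℂ] ℂ} {m : ℕ} {q r : ℝ}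
  (hb : ModeBounds ω w p m q r) {B : Finset Γ} (hB : B.card = m)
include hb hB

theorem norm_apply_lie_couplingSum_lie_term_le {β : Γ} (hβ : β ∈ B) {c : Γ → ℝ}
    (hc₀ : ∀ γ, 0 ≤ c γ) (hc₁ : ∀ γ, c γ ≤ 1) (hc : ∑ γ, c γ * w γ ^ 2 ≤ 1 / 8) :
    ‖ω ⁅couplingSum X c, ⁅X β, p B⁆⁆‖
      ≤ 6 * m * (r ^ 2 + q ^ 2) * (∏ i ∈ B, w i) ^ 2 := by
  have hsplit : couplingSum X c = ∑ γ ∈ B, (c γ : ℂ) • X γ + ∑ γ ∈ Bᶜ, (c γ : ℂ) • X γ :=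
    (Finset.sum_add_sum_compl B _).symm
  have hinside : ‖ω ⁅∑ γ ∈ B, (c γ : ℂ) • X γ, ⁅X β, p B⁆⁆‖
      ≤ m * ((2 * (q * r) + 4 * q ^ 2) * (∏ i ∈ B, w i) ^ 2) := by
    rw [sum_lie, map_sum, ← hB, ← nsmul_eq_mul]
    refine (norm_sum_le _ _).trans (Finset.sum_le_card_nsmul _ _ _ fun γ hγ => ?_)
    rw [smul_lie, map_smul, norm_smul, Complex.norm_of_nonneg (hc₀ γ)]
    exact (mul_le_of_le_one_left (norm_nonneg _) (hc₁ γ)).trans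
      (hX.norm_apply_lie_lie_term_le hb hB hγ hβ)
  have houtside : ‖ω ⁅∑ γ ∈ Bᶜ, (c γ : ℂ) • X γ, ⁅X β, p B⁆⁆‖
      ≤ (2 * (q * r) + r ^ 2) * (∏ i ∈ B, w i) ^ 2 :=
    hX.norm_apply_lie_lie_sum_outside_le hb hB hβ (Finset.disjoint_left.2 fun γ hγ =>
      Finset.mem_compl.1 hγ) hc₀ hc₁ ((Finset.sum_le_univ_sum_of_nonneg fun γ =>
      mul_nonneg (hc₀ γ) (sq_nonneg _)).trans hc)
  have hm : (1 : ℝ) ≤ m := by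
    rw [← hB]; exact_mod_cast Finset.card_pos.2 ⟨β, hβ⟩
  have hqr : m * (2 * (q * r) + 4 * q ^ 2) + (2 * (q * r) + r ^ 2)
      ≤ 6 * m * (r ^ 2 + q ^ 2) := by
    nlinarith [mul_nonneg (zero_le_one.trans hm) (sq_nonneg (r - q)), sq_nonneg (r - q),
      mul_nonneg (sub_nonneg.2 hm) (sq_nonneg r), mul_nonneg (sub_nonneg.2 hm) (sq_nonneg q)]
  rw [hsplit, add_lie, map_add]
  calc _ ≤ m * ((2 * (q * r) + 4 * q ^ 2) * (∏ i ∈ B, w i) ^ 2)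
        + (2 * (q * r) + r ^ 2) * (∏ i ∈ B, w i) ^ 2 :=
        (norm_add_le _ _).trans (add_le_add hinside houtside)
    _ = (m * (2 * (q * r) + 4 * q ^ 2) + (2 * (q * r) + r ^ 2)) * (∏ i ∈ B, w i) ^ 2 := by ring
    _ ≤ _ := mul_le_mul_of_nonneg_right hqr (sq_nonneg _)

theorem norm_apply_lie_lie_couplingSum_le {c : Γ → ℝ} (hc₀ : ∀ γ, 0 ≤ c γ)
    (hc₁ : ∀ γ, c γ ≤ 1) (hc : ∑ γ, c γ * w γ ^ 2 ≤ 1 / 8) :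
    ‖ω ⁅couplingSum X c, ⁅couplingSum X c, p B⁆⁆‖
      ≤ (∑ β ∈ B, c β) * (6 * m * (r ^ 2 + q ^ 2) * (∏ i ∈ B, w i) ^ 2) := by
  rw [hX.lie_couplingSum_proj c B, lie_sum, map_sum, Finset.sum_mul]
  refine (norm_sum_le _ _).trans (Finset.sum_le_sum fun β hβ => ?_)
  rw [lie_smul, map_smul, norm_smul, Complex.norm_of_nonneg (hc₀ β)]
  exact mul_le_mul_of_nonneg_left
    (hX.norm_apply_lie_couplingSum_lie_term_le hb hB hβ hc₀ hc₁ hc) (hc₀ β)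

theorem norm_apply_sum_lie_lie_couplingSum_le [Fintype J] {c : J → Γ → ℝ} {l : ℝ}
    (hc : WeakCoupling c w l) :
    ‖ω (∑ a, (-2 : ℂ) • ⁅couplingSum X (c a), ⁅couplingSum X (c a), p B⁆⁆)‖
      ≤ 12 * l * m ^ 2 * (r ^ 2 + q ^ 2) * (∏ i ∈ B, w i) ^ 2 := by
  have hrate : ∑ a, ∑ β ∈ B, c a β ≤ m * l := by
    rw [Finset.sum_comm, ← hB, ← nsmul_eq_mul]
    exact Finset.sum_le_card_nsmul _ _ _ fun β _ => hc.sum_le β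
  calc _ ≤ ∑ a, 2 * ((∑ β ∈ B, c a β)
          * (6 * m * (r ^ 2 + q ^ 2) * (∏ i ∈ B, w i) ^ 2)) := by
        rw [map_sum]
        refine (norm_sum_le _ _).trans (Finset.sum_le_sum fun a _ => ?_)
        rw [map_smul, norm_smul, norm_neg, Complex.norm_ofNat]
        exact mul_le_mul_of_nonneg_left (hX.norm_apply_lie_lie_couplingSum_le hb hB (hc.nonneg a)
          (hc.le_one a) (hc.sum_mul_sq_le a)) zero_le_two
    _ = (∑ a, ∑ β ∈ B, c a β) * (2 * (6 * m * (r ^ 2 + q ^ 2) * (∏ i ∈ B, w i) ^ 2)) := by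
        rw [Finset.sum_mul]
        exact Finset.sum_congr rfl fun a _ => by ring
    _ ≤ m * l * (2 * (6 * m * (r ^ 2 + q ^ 2) * (∏ i ∈ B, w i) ^ 2)) :=
        mul_le_mul_of_nonneg_right hrate (by positivity)
    _ = _ := by ring

end ModeSystem

end WeakCoupling

section Exponential

variable {E F : Type*} [NormedAddCommGroup E] [NormedSpace ℂ E] [CompleteSpace E]
  [NormedAddCommGroup F] [NormedSpace ℂ F] [CompleteSpace F]

theorem exp_apply_of_semiconj {Φ : F →L[ℂ] F} {Ψ : E →L[ℂ] E} {D : E →L[ℂ] F}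
    (h : Φ.comp D = D.comp Ψ) (x : E) : exp Φ (D x) = D (exp Ψ x) := by
  have hpow : ∀ n, (Φ ^ n).comp D = D.comp (Ψ ^ n) := by
    intro n
    induction n with
    | zero => rfl
    | succ n ih =>
      rw [pow_succ, pow_succ, ContinuousLinearMap.mul_def, ContinuousLinearMap.mul_def,
        ContinuousLinearMap.comp_assoc, h, ← ContinuousLinearMap.comp_assoc, ih,
        ContinuousLinearMap.comp_assoc]
  have hΦ := (exp_series_hasSum_exp' (𝕂 := ℂ) Φ).mapL (ContinuousLinearMap.apply ℂ F (D x))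
  have hΨ := (exp_series_hasSum_exp' (𝕂 := ℂ) Ψ).mapL
    (D.comp (ContinuousLinearMap.apply ℂ E x))
  refine hΦ.unique ?_
  convert! hΨ using 2 with n
  simpa using congrArg _ (DFunLike.congr_fun (hpow n) x)

theorem exp_apply_of_apply_eq_zero {Φ : E →L[ℂ] E} {x : E} (h : Φ x = 0) : exp Φ x = x := by
  simpa using exp_apply_of_semiconj (D := ContinuousLinearMap.toSpanSingleton ℂ x)
    (Φ := Φ) (Ψ := 0) (by ext; simp [h]) 1

theorem hasDerivAt_re_apply_exp (f : E →L[ℂ] ℂ) (Φ : E →L[ℂ] E) (x : E) (t : ℝ) :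
    HasDerivAt (fun s : ℝ => (f (exp ((s : ℂ) • Φ) x)).re)
      (f (exp ((t : ℂ) • Φ) (Φ x))).re t :=
  ((f.comp (ContinuousLinearMap.apply ℂ E x)).hasFDerivAt.comp_hasDerivAt (t : ℂ)
    (hasDerivAt_exp_smul_const (𝕂 := ℂ) Φ (t : ℂ))).real_of_complex

end Exponential

section Positivity

variable {𝓑 : Type*} [CStarAlgebra 𝓑]

/-- The Heisenberg-picture Lindblad generator with the jump operators `K`. -/
noncomputable def gksl {J : Type*} [Fintype J] (K : J → 𝓑) : 𝓑 →L[ℂ] 𝓑 :=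
  ∑ a, (ContinuousLinearMap.mulLeftRight ℂ 𝓑 (star (K a)) (K a)
    - (1 / 2 : ℂ) • (ContinuousLinearMap.mul ℂ 𝓑 (star (K a) * K a)
      + (ContinuousLinearMap.mul ℂ 𝓑).flip (star (K a) * K a)))

theorem gksl_apply {J : Type*} [Fintype J] (K : J → 𝓑) (x : 𝓑) :
    gksl K x = ∑ a, (star (K a) * x * K a
      - (1 / 2 : ℂ) • (star (K a) * K a * x + x * (star (K a) * K a))) := by
  simp [gksl]

variable [PartialOrder 𝓑]

/-- A bounded linear map that sends positive elements to positive elements. -/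
def PreservesPositivity (Φ : 𝓑 →L[ℂ] 𝓑) : Prop := ∀ ⦃x⦄, 0 ≤ x → 0 ≤ Φ x

/-- The pullback of a positive functional along a positivity-preserving map. -/
noncomputable def pullback [StarOrderedRing 𝓑] (ω : 𝓑 →ₚ[ℂ] ℂ) {Φ : 𝓑 →L[ℂ] 𝓑}
    (hΦ : PreservesPositivity Φ) : 𝓑 →ₚ[ℂ] ℂ :=
  PositiveLinearMap.mk₀ (ω.toLinearMap ∘ₗ Φ.toLinearMap) fun _ hx => map_nonneg ω (hΦ hx)

namespace PreservesPositivity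

variable {Φ Ψ : 𝓑 →L[ℂ] 𝓑}

theorem pow (hΦ : PreservesPositivity Φ) (n : ℕ) : PreservesPositivity (Φ ^ n) := by
  induction n with
  | zero => exact fun _ hx => hx
  | succ n ih => exact fun x hx => pow_succ Φ n ▸ ih (hΦ hx)

variable [StarOrderedRing 𝓑]

theorem add (hΦ : PreservesPositivity Φ) (hΨ : PreservesPositivity Ψ) :
    PreservesPositivity (Φ + Ψ) := fun _ hx => add_nonneg (hΦ hx) (hΨ hx)

theorem smul (hΦ : PreservesPositivity Φ) {c : ℝ} (hc : 0 ≤ c) :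
    PreservesPositivity ((c : ℂ) • Φ) := fun _ hx =>
  smul_nonneg (Complex.zero_le_real.2 hc) (hΦ hx)

theorem sum {ι : Type*} {s : Finset ι} {Φ : ι → 𝓑 →L[ℂ] 𝓑}
    (h : ∀ i ∈ s, PreservesPositivity (Φ i)) : PreservesPositivity (∑ i ∈ s, Φ i) := fun x hx => by
  rw [sum_apply]
  exact Finset.sum_nonneg fun i hi => h i hi hx

theorem mulLeftRight (u : 𝓑) :
    PreservesPositivity (ContinuousLinearMap.mulLeftRight ℂ 𝓑 (star u) u) := fun _ hx => by
  simpa using star_left_conjugate_nonneg hx u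

theorem isClosed : IsClosed {Φ : 𝓑 →L[ℂ] 𝓑 | PreservesPositivity Φ} := by
  simp only [PreservesPositivity, Set.ofPred_forall]
  exact isClosed_iInter fun x => isClosed_iInter fun _ =>
    isClosed_le continuous_const (ContinuousLinearMap.apply ℂ 𝓑 x).continuous

theorem exp (hΦ : PreservesPositivity Φ) : PreservesPositivity (exp Φ) := by
  refine isClosed.mem_of_tendsto (exp_series_hasSum_exp' (𝕂 := ℂ) Φ)
    (Eventually.of_forall fun s => sum fun n _ => ?_)
  simpa using (hΦ.pow n).smul (c := ((n.factorial : ℝ))⁻¹) (by positivity)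

theorem exp_smul_of_add_smul_one {t μ : ℝ} (ht : 0 ≤ t)
    (hΦ : PreservesPositivity (Φ + (μ : ℂ) • 1)) :
    PreservesPositivity (NormedSpace.exp ((t : ℂ) • Φ)) := by
  let _ : NormedAlgebra ℚ (𝓑 →L[ℂ] 𝓑) := NormedAlgebra.restrictScalars ℚ ℂ _
  have hshift : (t : ℂ) • Φ
      = algebraMap ℂ (𝓑 →L[ℂ] 𝓑) ((-(t * μ) : ℝ) : ℂ) + (t : ℂ) • (Φ + (μ : ℂ) • 1) := by
    rw [Algebra.algebraMap_eq_smul_one]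
    push_cast
    module
  rw [hshift, exp_add_of_commute (Algebra.commutes _ _), ← algebraMap_exp_comm,
    Algebra.algebraMap_eq_smul_one, smul_mul_assoc, one_mul, ← Complex.exp_eq_exp_ℂ,
    ← Complex.ofReal_exp]
  exact (hΦ.smul ht).exp.smul (Real.exp_pos _).le

end PreservesPositivity

variable [StarOrderedRing 𝓑] {J : Type*} [Fintype J] (K : J → 𝓑)

/- Completing the square: with `P = ∑ K* K`, the loss term `-(P x + x P) / 2` differs from
`μ (1 - P / (2 μ)) x (1 - P / (2 μ)) - μ x` only by `P x P / (4 μ)`, which vanishes as `μ → ∞`. -/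
theorem preservesPositivity_gksl_add {μ : ℝ} (hμ : 0 < μ) :
    PreservesPositivity (gksl K + ((4 * μ)⁻¹ : ℂ) •
        ContinuousLinearMap.mulLeftRight ℂ 𝓑 (∑ a, star (K a) * K a) (∑ a, star (K a) * K a)
      + (μ : ℂ) • 1) := by
  set P := ∑ a, star (K a) * K a with hP
  set u : 𝓑 := 1 - ((2 * μ)⁻¹ : ℂ) • P with hu
  have hustar : star u = u := by simp [hu, hP, star_sum]
  have hsquare : gksl K + ((4 * μ)⁻¹ : ℂ) • ContinuousLinearMap.mulLeftRight ℂ 𝓑 P P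
      + (μ : ℂ) • 1 = ∑ a, ContinuousLinearMap.mulLeftRight ℂ 𝓑 (star (K a)) (K a)
      + (μ : ℂ) • ContinuousLinearMap.mulLeftRight ℂ 𝓑 (star u) u := by
    ext x
    have hgksl : gksl K x = ∑ a, star (K a) * x * K a - (1 / 2 : ℂ) • (P * x + x * P) := by
      rw [gksl_apply, Finset.sum_sub_distrib, ← Finset.smul_sum, Finset.sum_add_distrib, hP,
        Finset.sum_mul, Finset.mul_sum]
    have hconj : u * x * u
        = x - (2 * μ : ℂ)⁻¹ • (P * x + x * P) + ((2 * μ : ℂ)⁻¹ * (2 * μ : ℂ)⁻¹) • (P * x * P) := by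
      simp only [hu, sub_mul, mul_sub, one_mul, mul_one, smul_mul_assoc, mul_smul_comm, smul_add,
        smul_sub, mul_smul]
      abel
    have hμ' : (μ : ℂ) ≠ 0 := by exact_mod_cast hμ.ne'
    simp only [hustar, add_apply, smul_apply, sum_apply, one_apply_eq_self,
      ContinuousLinearMap.mulLeftRight_apply, hgksl, hconj]
    have h₁ : (μ : ℂ) * (2 * μ : ℂ)⁻¹ = 1 / 2 := by field_simp
    have h₂ : (μ : ℂ) * ((2 * μ : ℂ)⁻¹ * (2 * μ : ℂ)⁻¹) = (4 * μ : ℂ)⁻¹ := by field_simp; norm_num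
    have hscale : (μ : ℂ) • (x - (2 * μ : ℂ)⁻¹ • (P * x + x * P)
          + ((2 * μ : ℂ)⁻¹ * (2 * μ : ℂ)⁻¹) • (P * x * P))
        = (μ : ℂ) • x - (1 / 2 : ℂ) • (P * x + x * P) + (4 * μ : ℂ)⁻¹ • (P * x * P) := by
      rw [smul_add, smul_sub, smul_smul, smul_smul, h₁, h₂]
    rw [hscale]
    abel
  rw [hsquare]
  exact (PreservesPositivity.sum fun a _ => PreservesPositivity.mulLeftRight (K a)).add
    ((PreservesPositivity.mulLeftRight u).smul hμ.le)

theorem preservesPositivity_exp_gksl {t : ℝ} (ht : 0 ≤ t) :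
    PreservesPositivity (exp ((t : ℂ) • gksl K)) := by
  let _ : NormedAlgebra ℚ (𝓑 →L[ℂ] 𝓑) := NormedAlgebra.restrictScalars ℚ ℂ _
  set R := ContinuousLinearMap.mulLeftRight ℂ 𝓑 (∑ a, star (K a) * K a) (∑ a, star (K a) * K a)
  have hinv : Tendsto (fun μ : ℝ => (4 * μ : ℂ)⁻¹) atTop (𝓝 0) := by
    have := (Complex.continuous_ofReal.tendsto 0).comp
      (tendsto_inv_atTop_zero.comp (tendsto_id.const_mul_atTop (zero_lt_four' ℝ)))
    simpa [Function.comp_def] using this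
  have hlim : Tendsto (fun μ : ℝ => (t : ℂ) • (gksl K + (4 * μ : ℂ)⁻¹ • R)) atTop
      (𝓝 ((t : ℂ) • gksl K)) := by
    have := (tendsto_const_nhds (x := gksl K)).add (hinv.smul_const R) |>.const_smul (t : ℂ)
    rwa [zero_smul, add_zero] at this
  refine PreservesPositivity.isClosed.mem_of_tendsto hlim.exp ?_
  filter_upwards [eventually_gt_atTop 0] with μ hμ
  exact PreservesPositivity.exp_smul_of_add_smul_one ht (preservesPositivity_gksl_add K hμ)

end Positivity

theorem gronwallBound_zero_mul (K C t : ℝ) :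
    gronwallBound 0 K (K * C) t = C * (Real.exp (K * t) - 1) := by
  by_cases h : K = 0
  · simp [h, gronwallBound_K0]
  · rw [gronwallBound_of_K_ne_0 h]
    field_simp
    ring

/-- The constant in the bound on the joint occupation of `m` modes, which picks up a factor
`exp (12 m ^ 2)` from Grönwall's inequality at each `m`. -/
noncomputable def momentBound : ℕ → ℝ
  | 0 => 1
  | m + 1 => Real.exp (12 * ((m + 1 : ℕ) : ℝ) ^ 2) * momentBound m

theorem one_le_momentBound (m : ℕ) : 1 ≤ momentBound m := by
  induction m with
  | zero => exact le_rfl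
  | succ m ih => exact one_le_mul_of_one_le_of_one_le (Real.one_le_exp (by positivity)) ih

theorem momentBound_mono : Monotone momentBound := monotone_nat_of_le_succ fun m =>
  le_mul_of_one_le_left (zero_le_one.trans (one_le_momentBound m)) (Real.one_le_exp (by positivity))

section VacuumEvolution

variable {𝓑 : Type*} [CStarAlgebra 𝓑] {Γ J : Type*} [Fintype J]

theorem gksl_isometry_mul_apply {A Z : J → 𝓑} (hA : ∀ a, star (A a) * A a = 1)
    (hZ : ∀ a, IsSelfAdjoint (Z a)) {x : 𝓑} (hx : ∀ a, Commute (A a) x) :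
    gksl (fun a => A a * Z a) x = ∑ a, (-(1 / 2) : ℂ) • ⁅Z a, ⁅Z a, x⁆⁆ := by
  rw [gksl_apply]
  refine Finset.sum_congr rfl fun a _ => ?_
  have hloss : star (A a * Z a) * (A a * Z a) = Z a * Z a := by
    rw [star_mul, (hZ a).star_eq, mul_assoc, ← mul_assoc (star (A a)), hA, one_mul]
  have hgain : star (A a * Z a) * x * (A a * Z a) = Z a * x * Z a := by
    rw [star_mul, (hZ a).star_eq, mul_assoc, ← mul_assoc x, ← (hx a).eq, mul_assoc (A a),
      mul_assoc (Z a), ← mul_assoc (star (A a)), hA, one_mul, mul_assoc]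
  rw [hloss, hgain, Ring.lie_def, Ring.lie_def, mul_sub, sub_mul]
  simp only [mul_assoc, smul_add, smul_sub]
  module

/-- The jump operators `A a (1 + 2 ∑ γ, c a γ X γ)`. -/
noncomputable def modeJump [Fintype Γ] (X : Γ → 𝓑) (A : J → 𝓑) (c : J → Γ → ℝ)
    (a : J) : 𝓑 :=
  A a * (1 + (2 : ℂ) • couplingSum X (c a))

variable [PartialOrder 𝓑]

/-- The functional `ω` after time `t` of the evolution with the jump operators `K`. -/
noncomputable def evolvedState [StarOrderedRing 𝓑] (ω : 𝓑 →ₚ[ℂ] ℂ) (K : J → 𝓑) {t : ℝ}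
    (ht : 0 ≤ t) : 𝓑 →ₚ[ℂ] ℂ :=
  pullback ω (preservesPositivity_exp_gksl K ht)

/-- The probability that all modes in `B` are occupied at time `t`. -/
noncomputable def occupation (ω : 𝓑 →ₚ[ℂ] ℂ) (K : J → 𝓑) (p : Finset Γ → 𝓑) (t : ℝ)
    (B : Finset Γ) : ℝ :=
  (ω (exp ((t : ℂ) • gksl K) (p B))).re

/-- The occupation of sets of `m` modes, relative to the squared product of their weights. -/
noncomputable def relativeOccupation (ω : 𝓑 →ₚ[ℂ] ℂ) (K : J → 𝓑) (p : Finset Γ → 𝓑) (w : Γ → ℝ)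
    (m : ℕ) (t : ℝ) (B : {B : Finset Γ // B.card = m}) : ℝ :=
  occupation ω K p t B / (∏ γ ∈ B.1, w γ) ^ 2

theorem hasDerivAt_relativeOccupation [StarOrderedRing 𝓑] (ω : 𝓑 →ₚ[ℂ] ℂ) (K : J → 𝓑)
    (p : Finset Γ → 𝓑) (w : Γ → ℝ) (m : ℕ) (t : ℝ) :
    HasDerivAt (relativeOccupation ω K p w m)
      (fun B => (ω (exp ((t : ℂ) • gksl K) (gksl K (p B.1)))).re / (∏ γ ∈ B.1, w γ) ^ 2) t :=
  hasDerivAt_pi.2 fun B =>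
    (hasDerivAt_re_apply_exp ⟨ω.toLinearMap, map_continuous ω⟩ _ (p B.1) t).div_const _

variable [Fintype Γ]

/-- A mode system that starts in a state `ω` without occupied modes and is weakly coupled to the
jumps `modeJump X A c`, whose isometric parts `A a` commute with the modes. -/
structure VacuumEvolution [DecidableEq Γ] (ω : 𝓑 →ₚ[ℂ] ℂ) (X : Γ → 𝓑) (w : Γ → ℝ)
    (p : Finset Γ → 𝓑) (A : J → 𝓑) (c : J → Γ → ℝ) (l : ℝ) : Prop
    extends ModeSystem X w p, WeakCoupling c w l where
  isometry : ∀ a, star (A a) * A a = 1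
  commute_jump : ∀ a B, Commute (A a) (p B)
  map_one : ω 1 = 1
  map_proj : ∀ B : Finset Γ, B.Nonempty → ω (p B) = 0

namespace VacuumEvolution

variable [DecidableEq Γ] {ω : 𝓑 →ₚ[ℂ] ℂ} {X : Γ → 𝓑} {w : Γ → ℝ} {p : Finset Γ → 𝓑}
  {A : J → 𝓑} {c : J → Γ → ℝ} {l : ℝ} (V : VacuumEvolution ω X w p A c l)
include V

theorem gksl_proj (B : Finset Γ) : gksl (modeJump X A c) (p B)
    = ∑ a, (-2 : ℂ) • ⁅couplingSum X (c a), ⁅couplingSum X (c a), p B⁆⁆ := by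
  have hself : ∀ a, IsSelfAdjoint (1 + (2 : ℂ) • couplingSum X (c a)) := fun a => by
    simp [IsSelfAdjoint, (V.isSelfAdjoint_couplingSum (c a)).star_eq]
  have hlie : ∀ a (x : 𝓑), ⁅1 + (2 : ℂ) • couplingSum X (c a), x⁆
      = (2 : ℂ) • ⁅couplingSum X (c a), x⁆ := by
    intro a x
    rw [add_lie, smul_lie, Ring.lie_def 1, one_mul, mul_one, sub_self, zero_add]
  rw [show modeJump X A c = fun a => A a * (1 + (2 : ℂ) • couplingSum X (c a)) from rfl,
    gksl_isometry_mul_apply V.isometry hself fun a => V.commute_jump a B]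
  refine Finset.sum_congr rfl fun a _ => ?_
  rw [hlie, hlie, lie_smul, smul_smul, smul_smul]
  norm_num

theorem occupation_empty (t : ℝ) : occupation ω (modeJump X A c) p t ∅ = 1 := by
  have hzero : ((t : ℂ) • gksl (modeJump X A c)) (p ∅) = 0 := by
    rw [smul_apply, V.gksl_proj, V.empty]
    simp [Ring.lie_def]
  rw [occupation, exp_apply_of_apply_eq_zero hzero, V.empty, V.map_one, Complex.one_re]

theorem occupation_zero {B : Finset Γ} (hB : B.Nonempty) :
    occupation ω (modeJump X A c) p 0 B = 0 := by
  rw [occupation, exp_apply_of_apply_eq_zero (by simp), V.map_proj B hB, Complex.zero_re]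

variable [StarOrderedRing 𝓑]

theorem occupation_eq_sq {t : ℝ} (ht : 0 ≤ t) (B : Finset Γ) :
    occupation ω (modeJump X A c) p t B
      = twoNorm (evolvedState ω (modeJump X A c) ht) (p B) ^ 2 :=
  (V.toModeProjections.twoNorm_sq (evolvedState ω (modeJump X A c) ht) B).symm

theorem occupation_eq_zero_of_weight_eq_zero {t : ℝ} (ht : 0 ≤ t) {B : Finset Γ} {β : Γ}
    (hβ : β ∈ B) (hw : w β = 0) : occupation ω (modeJump X A c) p t B = 0 := by
  have hX : X β = 0 := norm_le_zero_iff.1 (hw ▸ V.norm_le β)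
  have hgen : ((t : ℂ) • gksl (modeJump X A c)) (p {β}) = 0 := by
    simp [V.gksl_proj, V.lie_couplingSum_proj, hX]
  have hsingle : occupation ω (modeJump X A c) p t {β} = 0 := by
    rw [occupation, exp_apply_of_apply_eq_zero hgen, V.map_proj _ (Finset.singleton_nonempty β),
      Complex.zero_re]
  rw [V.occupation_eq_sq ht, sq_eq_zero_iff] at hsingle ⊢
  exact le_antisymm (hsingle ▸ V.twoNorm_anti _ (Finset.singleton_subset_iff.2 hβ)) (norm_nonneg _)

theorem twoNorm_evolvedState_proj_le {t : ℝ} (ht : 0 ≤ t) {B : Finset Γ} {M : ℝ} (hM : 0 ≤ M)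
    (h : occupation ω (modeJump X A c) p t B ≤ M * (∏ γ ∈ B, w γ) ^ 2) :
    twoNorm (evolvedState ω (modeJump X A c) ht) (p B) ≤ √M * ∏ γ ∈ B, w γ := by
  refine le_of_sq_le_sq ?_ (mul_nonneg M.sqrt_nonneg (Finset.prod_nonneg fun γ _ =>
    V.weight_nonneg γ))
  rwa [← V.occupation_eq_sq, mul_pow, Real.sq_sqrt hM]

theorem occupation_le_norm_relativeOccupation {t : ℝ} (ht : 0 ≤ t) {B : Finset Γ} {m : ℕ}
    (hB : B.card = m) : occupation ω (modeJump X A c) p t B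
      ≤ ‖relativeOccupation ω (modeJump X A c) p w m t‖ * (∏ γ ∈ B, w γ) ^ 2 := by
  by_cases hW : ∏ γ ∈ B, w γ = 0
  · obtain ⟨β, hβ, hwβ⟩ := Finset.prod_eq_zero_iff.1 hW
    rw [V.occupation_eq_zero_of_weight_eq_zero ht hβ hwβ, hW, sq, mul_zero, mul_zero]
  · have hcoord := (le_abs_self _).trans
      (norm_le_pi_norm (relativeOccupation ω (modeJump X A c) p w m t) ⟨B, hB⟩)
    exact (div_le_iff₀ (pow_pos ((Finset.prod_nonneg fun γ _ =>
      V.weight_nonneg γ).lt_of_ne' hW) 2)).1 hcoord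

theorem modeBounds {t : ℝ} (ht : 0 ≤ t) {m : ℕ} {Q : ℝ} (hQ : 0 ≤ Q)
    (h : ∀ B : Finset Γ, B.card < m →
      occupation ω (modeJump X A c) p t B ≤ Q * (∏ γ ∈ B, w γ) ^ 2) :
    ModeBounds (evolvedState ω (modeJump X A c) ht) w p m √Q
      √‖relativeOccupation ω (modeJump X A c) p w m t‖ where
  left_nonneg := Q.sqrt_nonneg
  right_nonneg := Real.sqrt_nonneg _
  le_of_card_lt B hB := V.twoNorm_evolvedState_proj_le ht hQ (h B hB)
  le_of_card_eq _ hB := V.twoNorm_evolvedState_proj_le ht (norm_nonneg _)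
    (V.occupation_le_norm_relativeOccupation ht hB)

theorem norm_deriv_relativeOccupation_le {t : ℝ} (ht : 0 ≤ t) {m : ℕ} {Q : ℝ} (hQ : 0 ≤ Q)
    (h : ∀ B : Finset Γ, B.card < m →
      occupation ω (modeJump X A c) p t B ≤ Q * (∏ γ ∈ B, w γ) ^ 2) :
    ‖fun B : {B : Finset Γ // B.card = m} =>
        (ω (exp ((t : ℂ) • gksl (modeJump X A c)) (gksl (modeJump X A c) (p B.1)))).re
          / (∏ γ ∈ B.1, w γ) ^ 2‖
      ≤ 12 * l * m ^ 2 * ‖relativeOccupation ω (modeJump X A c) p w m t‖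
        + 12 * l * m ^ 2 * Q := by
  have hl := V.rate_nonneg
  have hbound : 0 ≤ 12 * l * m ^ 2 * ‖relativeOccupation ω (modeJump X A c) p w m t‖
      + 12 * l * m ^ 2 * Q := by positivity
  refine (pi_norm_le_iff_of_nonneg hbound).2 fun B => ?_
  have hgen := V.norm_apply_sum_lie_lie_couplingSum_le (V.modeBounds ht hQ h) B.2 V.toWeakCoupling
  rw [← V.gksl_proj, Real.sq_sqrt hQ, Real.sq_sqrt (norm_nonneg _), mul_add] at hgen
  rw [Real.norm_eq_abs, abs_div, abs_of_nonneg (sq_nonneg (∏ γ ∈ B.1, w γ))]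
  exact div_le_of_le_mul₀ (sq_nonneg _) hbound ((Complex.abs_re_le_norm _).trans hgen)

theorem occupation_le_of_card_eq {T : ℝ} (hT : l * T ≤ 1) {m : ℕ} (hm : 0 < m) {Q : ℝ}
    (hQ : 0 ≤ Q) (h : ∀ t ∈ Set.Icc 0 T, ∀ B : Finset Γ, B.card < m →
      occupation ω (modeJump X A c) p t B ≤ Q * (∏ γ ∈ B, w γ) ^ 2)
    {t : ℝ} (ht : t ∈ Set.Icc 0 T) {B : Finset Γ} (hB : B.card = m) :
    occupation ω (modeJump X A c) p t B
      ≤ Real.exp (12 * m ^ 2) * Q * (∏ γ ∈ B, w γ) ^ 2 := by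
  have hderiv := hasDerivAt_relativeOccupation ω (modeJump X A c) p w m
  have hinitial : ‖relativeOccupation ω (modeJump X A c) p w m 0‖ ≤ 0 :=
    (pi_norm_le_iff_of_nonneg le_rfl).2 fun B => by
      rw [relativeOccupation, V.occupation_zero (Finset.card_pos.1 (hm.trans_eq B.2.symm)),
        zero_div, norm_zero]
  have hgronwall := norm_le_gronwallBound_of_norm_deriv_right_le
    (fun s _ => (hderiv s).continuousAt.continuousWithinAt)
    (fun s _ => (hderiv s).hasDerivWithinAt) hinitial
    (fun s hs => V.norm_deriv_relativeOccupation_le hs.1 hQ (h s (Set.Ico_subset_Icc_self hs)))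
    t ht
  have hexponent : 12 * l * m ^ 2 * t ≤ 12 * m ^ 2 := by
    nlinarith [sq_nonneg (m : ℝ), mul_le_mul_of_nonneg_left ht.2 V.rate_nonneg]
  rw [gronwallBound_zero_mul, sub_zero] at hgronwall
  refine (V.occupation_le_norm_relativeOccupation ht.1 hB).trans
    (mul_le_mul_of_nonneg_right ?_ (sq_nonneg _))
  nlinarith [Real.exp_le_exp.2 hexponent]

theorem occupation_le {T : ℝ} (hT : l * T ≤ 1) (m : ℕ) {t : ℝ} (ht : t ∈ Set.Icc 0 T)
    {B : Finset Γ} (hB : B.card ≤ m) :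
    occupation ω (modeJump X A c) p t B ≤ momentBound m * (∏ γ ∈ B, w γ) ^ 2 := by
  induction m generalizing t B with
  | zero =>
    rw [Finset.card_eq_zero.1 (Nat.le_zero.1 hB), V.occupation_empty]
    simp [momentBound]
  | succ m ih =>
    rcases hB.lt_or_eq with hlt | heq
    · exact (ih ht (Nat.lt_succ_iff.1 hlt)).trans
        (mul_le_mul_of_nonneg_right (momentBound_mono m.le_succ) (sq_nonneg _))
    · exact V.occupation_le_of_card_eq hT m.succ_pos (zero_le_one.trans (one_le_momentBound m))
        (fun s hs C hC => ih hs (Nat.lt_succ_iff.1 hC)) ht heq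

end VacuumEvolution

end VacuumEvolution

section SwitchesModes

variable {𝓑 : Type*} [CStarAlgebra 𝓑] {Γ : Type*}

/-- The element `x` toggles the occupation of every mode in `U`. -/
def SwitchesModes (p : Finset Γ → 𝓑) (U : Finset Γ) (x : 𝓑) : Prop :=
  ∀ γ ∈ U, x * p {γ} = (1 - p {γ}) * x

variable [DecidableEq Γ] {p : Finset Γ → 𝓑}

/- Of the states before and after `x`, exactly one has a given mode of `U` occupied. -/
theorem SwitchesModes.eq_sum_powerset (hp : ModeProjections p) {U : Finset Γ} {x : 𝓑}
    (hx : SwitchesModes p U x) : x = ∑ B ∈ U.powerset, p B * x * p (U \ B) := by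
  induction U using Finset.induction_on with
  | empty => simp [hp.empty]
  | insert γ U hγ ih =>
    have hsplit : x = p {γ} * x + x * p {γ} := by
      rw [hx γ (Finset.mem_insert_self γ U)]
      noncomm_ring
    rw [Finset.sum_powerset_insert hγ, ← Finset.sum_add_distrib]
    nth_rewrite 1 [ih fun β hβ => hx β (Finset.mem_insert_of_mem hβ)]
    refine Finset.sum_congr rfl fun B hB => ?_
    have hγB : γ ∉ B := fun h => hγ (Finset.mem_powerset.1 hB h)
    rw [Finset.insert_sdiff_of_notMem _ hγB, Finset.insert_sdiff_insert,
      Finset.sdiff_insert_of_notMem hγ, Finset.insert_eq γ (U \ B), Finset.insert_eq γ B,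
      ← hp.mul, ← hp.mul, hp.mul_comm {γ} B]
    nth_rewrite 1 [hsplit]
    noncomm_ring

theorem VacuumEvolution.norm_evolvedState_le [PartialOrder 𝓑] [StarOrderedRing 𝓑]
    {J : Type*} [Fintype Γ] [Fintype J] {ω : 𝓑 →ₚ[ℂ] ℂ} {X : Γ → 𝓑} {w : Γ → ℝ} {A : J → 𝓑}
    {c : J → Γ → ℝ} {l : ℝ} (V : VacuumEvolution ω X w p A c l) {t : ℝ} (ht : 0 ≤ t)
    (hlt : l * t ≤ 1) {U : Finset Γ} {x : 𝓑} (hx : SwitchesModes p U x) :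
    ‖evolvedState ω (modeJump X A c) ht x‖
      ≤ 2 ^ U.card * momentBound U.card * ‖x‖ * ∏ γ ∈ U, w γ := by
  set φ := evolvedState ω (modeJump X A c) ht
  set M := momentBound U.card
  have hM : 0 ≤ M := zero_le_one.trans (one_le_momentBound _)
  have hproj : ∀ B ⊆ U, twoNorm φ (p B) ≤ √M * ∏ γ ∈ B, w γ := fun B hB =>
    V.twoNorm_evolvedState_proj_le ht hM
      (V.occupation_le hlt _ ⟨ht, le_rfl⟩ (Finset.card_le_card hB))
  have hterm : ∀ B ∈ U.powerset, ‖φ (p B * x * p (U \ B))‖ ≤ M * ‖x‖ * ∏ γ ∈ U, w γ := by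
    intro B hB
    calc ‖φ (p B * x * p (U \ B))‖ ≤ twoNorm φ (p B) * twoNorm φ (x * p (U \ B)) := by
          simpa only [V.star_eq, mul_assoc] using norm_apply_star_mul_le φ (p B) (x * p (U \ B))
      _ ≤ (√M * ∏ γ ∈ B, w γ) * (‖x‖ * (√M * ∏ γ ∈ U \ B, w γ)) :=
          mul_le_mul (hproj B (Finset.mem_powerset.1 hB)) ((twoNorm_mul_le φ _ _).trans
            (mul_le_mul_of_nonneg_left (hproj _ Finset.sdiff_subset) (norm_nonneg x)))
            (norm_nonneg _) (mul_nonneg M.sqrt_nonneg (Finset.prod_nonneg fun γ _ =>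
              V.weight_nonneg γ))
      _ = √M ^ 2 * ‖x‖ * ((∏ γ ∈ U \ B, w γ) * ∏ γ ∈ B, w γ) := by ring
      _ = M * ‖x‖ * ∏ γ ∈ U, w γ := by
          rw [Real.sq_sqrt hM, Finset.prod_sdiff (Finset.mem_powerset.1 hB)]
  calc ‖φ x‖ = ‖∑ B ∈ U.powerset, φ (p B * x * p (U \ B))‖ := by
        rw [← map_sum, ← hx.eq_sum_powerset V.toModeProjections]
    _ ≤ U.powerset.card • (M * ‖x‖ * ∏ γ ∈ U, w γ) :=
        (norm_sum_le _ _).trans (Finset.sum_le_card_nsmul _ _ _ hterm)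
    _ = 2 ^ U.card * M * ‖x‖ * ∏ γ ∈ U, w γ := by
        rw [Finset.card_powerset, nsmul_eq_mul]
        push_cast
        ring

end SwitchesModes

section StarAlgHom

open scoped CStarAlgebra

variable {𝓐 𝓑 : Type*} [CStarAlgebra 𝓐] [CStarAlgebra 𝓑] (π : 𝓐 →⋆ₐ[ℂ] 𝓑) {Γ J : Type*}

theorem map_modeJump [Fintype Γ] (X : Γ → 𝓐) (A : J → 𝓐) (c : J → Γ → ℝ) (a : J) :
    π (modeJump X A c a) = modeJump (fun γ => π (X γ)) (fun a => π (A a)) c a := by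
  simp only [modeJump, couplingSum, map_mul, map_add, map_one, map_smul, map_sum]

variable [Fintype J]

theorem map_exp_smul_gksl (K : J → 𝓐) (z : ℂ) (x : 𝓐) :
    π (exp (z • gksl K) x) = exp (z • gksl fun a => π (K a)) (π x) := by
  let D : 𝓐 →L[ℂ] 𝓑 := ⟨π.toAlgHom.toLinearMap, map_continuous π⟩
  have hπ : (z • gksl fun a => π (K a)).comp D = D.comp (z • gksl K) := by
    ext x
    change z • gksl (fun a => π (K a)) (π x) = π (z • gksl K x)
    simp only [gksl_apply, map_smul, map_sum, map_sub, map_add, map_mul, map_star]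
  exact (exp_apply_of_semiconj hπ x).symm

end StarAlgHom

theorem apply_nonneg_of_star_mul_self {𝓑 : Type*} [NonUnitalCStarAlgebra 𝓑] [PartialOrder 𝓑]
    [StarOrderedRing 𝓑] {f : 𝓑 →ₗ[ℂ] ℂ} (h : ∀ y, 0 ≤ f (star y * y)) {x : 𝓑} (hx : 0 ≤ x) :
    0 ≤ f x := by
  obtain ⟨y, rfl⟩ := CStarAlgebra.nonneg_iff_eq_star_mul_self.1 hx
  exact h y

section MatrixAlgebra

variable {𝓐 n : Type*} [CStarAlgebra 𝓐]

/-- Complex matrices, regarded as matrices over `𝓐`. -/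
noncomputable def scalarMatrix (M : Matrix n n ℂ) : CStarMatrix n n 𝓐 :=
  CStarMatrix.ofMatrix (M.map (algebraMap ℂ 𝓐))

theorem scalarMatrix_apply (M : Matrix n n ℂ) (i j : n) :
    (scalarMatrix M : CStarMatrix n n 𝓐) i j = algebraMap ℂ 𝓐 (M i j) := rfl

theorem star_scalarMatrix (M : Matrix n n ℂ) :
    star (scalarMatrix M : CStarMatrix n n 𝓐) = scalarMatrix M.conjTranspose := by
  ext i j
  rw [CStarMatrix.star_apply]
  simp only [scalarMatrix_apply, Matrix.conjTranspose_apply, algebraMap_star_comm]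

theorem scalarMatrix_one [DecidableEq n] : (scalarMatrix 1 : CStarMatrix n n 𝓐) = 1 :=
  Matrix.map_one _ (map_zero (algebraMap ℂ 𝓐)) (map_one (algebraMap ℂ 𝓐))

variable [Fintype n]

theorem scalarMatrix_mul (M N : Matrix n n ℂ) :
    (scalarMatrix (M * N) : CStarMatrix n n 𝓐) = scalarMatrix M * scalarMatrix N :=
  Matrix.map_mul (f := algebraMap ℂ 𝓐)

section Diagonal

variable [DecidableEq n]

/-- Families in `𝓐`, embedded as diagonal matrices. -/
def diagonal : (n → 𝓐) →⋆ₐ[ℂ] CStarMatrix n n 𝓐 where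
  toAlgHom := CStarMatrix.ofMatrixStarAlgEquiv.toStarAlgHom.toAlgHom.comp (Matrix.diagonalAlgHom ℂ)
  map_star' f := by
    ext i j
    exact congrFun₂ (Matrix.diagonal_conjTranspose f).symm i j

theorem diagonal_apply (f : n → 𝓐) (i j : n) :
    diagonal f i j = if i = j then f i else 0 := rfl

theorem diagonal_mul_apply (f : n → 𝓐) (M : CStarMatrix n n 𝓐) (i j : n) :
    (diagonal f * M) i j = f i * M i j :=
  Matrix.diagonal_mul f M i j

theorem mul_diagonal_apply (f : n → 𝓐) (M : CStarMatrix n n 𝓐) (i j : n) :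
    (M * diagonal f) i j = M i j * f j :=
  Matrix.mul_diagonal f M i j

end Diagonal

variable [PartialOrder 𝓐] [StarOrderedRing 𝓐]

/-- The state `M ↦ (1 / n) ∑ i j, φ (M i j)`, the tensor product of the state `φ` with the vector
state of the uniform unit vector. -/
noncomputable def uniformState (φ : 𝓐 →ₚ[ℂ] ℂ) : CStarMatrix n n 𝓐 →ₚ[ℂ] ℂ :=
  PositiveLinearMap.mk₀
    { toFun M := (Fintype.card n : ℂ)⁻¹ * ∑ i, ∑ j, φ (M i j)
      map_add' M N := by simp [Finset.sum_add_distrib, mul_add]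
      map_smul' z M := by simp [Finset.mul_sum, mul_left_comm] }
    fun _ => apply_nonneg_of_star_mul_self fun N => by
      have hgram : ∑ i, ∑ j, φ ((star N * N) i j)
          = ∑ l, φ (star (∑ i, N l i) * ∑ i, N l i) := by
        simp only [CStarMatrix.mul_apply, CStarMatrix.star_apply, map_sum, star_sum,
          Finset.sum_mul_sum]
        rw [Finset.sum_congr rfl fun i _ => Finset.sum_comm, Finset.sum_comm]
      refine mul_nonneg (by positivity) (hgram ▸ ?_)
      exact Finset.sum_nonneg fun l _ => map_nonneg φ (star_mul_self_nonneg _)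

theorem uniformState_apply (φ : 𝓐 →ₚ[ℂ] ℂ) (M : CStarMatrix n n 𝓐) :
    uniformState φ M = (Fintype.card n : ℂ)⁻¹ * ∑ i, ∑ j, φ (M i j) := rfl

theorem uniformState_scalarMatrix {φ : 𝓐 →ₚ[ℂ] ℂ} (hφ : φ 1 = 1) (M : Matrix n n ℂ) :
    uniformState φ (scalarMatrix M) = (Fintype.card n : ℂ)⁻¹ * ∑ i, ∑ j, M i j := by
  simp [uniformState_apply, scalarMatrix_apply, Algebra.algebraMap_eq_smul_one, hφ]

theorem uniformState_diagonal [DecidableEq n] (φ : 𝓐 →ₚ[ℂ] ℂ) (f : n → 𝓐) :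
    uniformState φ (diagonal f) = (Fintype.card n : ℂ)⁻¹ * ∑ i, φ (f i) := by
  simp [uniformState_apply, diagonal_apply, apply_ite]

end MatrixAlgebra

section SignModes

variable {Γ : Type*} [Fintype Γ]

/-- The entries of the matrix on functions of one sign that is the identity if `b` is false and,
if `b` is true, the projection onto the odd functions, i.e. onto the states in which the mode
given by this sign is occupied. -/
noncomputable def siteProj (b : Prop) [Decidable b] (u v : ℤˣ) : ℂ :=
  if b then ((u : ℤ) : ℂ) * (v : ℤ) / 2 else if u = v then 1 else 0

theorem siteProj_comm (b : Prop) [Decidable b] (u v : ℤˣ) : siteProj b u v = siteProj b v u := by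
  simp only [siteProj, mul_comm, eq_comm]

theorem star_siteProj (b : Prop) [Decidable b] (u v : ℤˣ) :
    star (siteProj b u v) = siteProj b u v := by
  unfold siteProj
  split_ifs <;> simp

theorem sum_siteProj_mul_siteProj (b c : Prop) [Decidable b] [Decidable c] (u v : ℤˣ) :
    ∑ w, siteProj b u w * siteProj c w v = siteProj (b ∨ c) u v := by
  rcases Int.units_eq_one_or u with rfl | rfl <;> rcases Int.units_eq_one_or v with rfl | rfl <;>
    by_cases hb : b <;> by_cases hc : c <;> simp [siteProj, hb, hc] <;> norm_num

theorem sum_sum_siteProj_of_true {b : Prop} [Decidable b] (hb : b) (u : ℤˣ) :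
    ∑ v, siteProj b u v = 0 := by
  simp [siteProj, hb, neg_div]

variable [DecidableEq Γ]

/-- The projection onto the functions of the signs `s : Γ → {1, -1}` that are odd in each `s γ`
with `γ ∈ B`: those in which all modes of `B` are occupied. -/
noncomputable def modeProj (B : Finset Γ) : Matrix (Γ → ℤˣ) (Γ → ℤˣ) ℂ :=
  Matrix.of fun s s' => ∏ γ, siteProj (γ ∈ B) (s γ) (s' γ)

theorem modeProj_apply (B : Finset Γ) (s s' : Γ → ℤˣ) :
    modeProj B s s' = ∏ γ, siteProj (γ ∈ B) (s γ) (s' γ) := rfl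

theorem modeProj_empty : modeProj (∅ : Finset Γ) = 1 := by
  ext s s'
  simp [modeProj_apply, siteProj, Finset.prod_ite_zero, Matrix.one_apply, funext_iff]

theorem conjTranspose_modeProj (B : Finset Γ) : (modeProj B).conjTranspose = modeProj B := by
  ext s s'
  simp only [Matrix.conjTranspose_apply, modeProj_apply, star_prod, star_siteProj, siteProj_comm]

theorem modeProj_mul (B C : Finset Γ) : modeProj B * modeProj C = modeProj (B ∪ C) := by
  ext s s'
  simp only [Matrix.mul_apply, modeProj_apply, ← Finset.prod_mul_distrib, Finset.mem_union,
    ← sum_siteProj_mul_siteProj, Finset.prod_univ_sum, Fintype.piFinset_univ]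

theorem sum_modeProj_of_nonempty {B : Finset Γ} (hB : B.Nonempty) (s : Γ → ℤˣ) :
    ∑ s', modeProj B s s' = 0 := by
  obtain ⟨β, hβ⟩ := hB
  simp only [modeProj_apply, ← Fintype.piFinset_univ]
  rw [← Finset.prod_univ_sum]
  exact Finset.prod_eq_zero (Finset.mem_univ β) (sum_sum_siteProj_of_true hβ _)

theorem modeProj_eq_zero_of_ne {B : Finset Γ} {s s' : Γ → ℤˣ} {γ : Γ} (hγ : γ ∉ B)
    (h : s γ ≠ s' γ) : modeProj B s s' = 0 :=
  Finset.prod_eq_zero (Finset.mem_univ γ) (by simp [siteProj, hγ, h])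

theorem modeProj_singleton_self (γ : Γ) (s : Γ → ℤˣ) : modeProj {γ} s s = 1 / 2 := by
  rw [modeProj_apply, Finset.prod_eq_single γ (fun δ _ hδ => by simp [siteProj, hδ]) (by simp)]
  rcases Int.units_eq_one_or (s γ) with h | h <;> simp [siteProj, h]

end SignModes

section SignedTerms

variable {𝓐 : Type*} [CStarAlgebra 𝓐] {Γ : Type*}

/-- The element `a`, multiplied by the random sign `∏ γ ∈ U, s γ`. -/
def signed (U : Finset Γ) (a : 𝓐) (s : Γ → ℤˣ) : 𝓐 := (∏ γ ∈ U, ((s γ : ℤ) : ℂ)) • a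

theorem signed_singleton (γ : Γ) (a : 𝓐) (s : Γ → ℤˣ) :
    signed {γ} a s = ((s γ : ℤ) : ℂ) • a := by
  rw [signed, Finset.prod_singleton]

theorem signed_congr {U : Finset Γ} (a : 𝓐) {s s' : Γ → ℤˣ} (h : ∀ γ ∈ U, s γ = s' γ) :
    signed U a s = signed U a s' := by
  rw [signed, signed, Finset.prod_congr rfl fun γ hγ => by rw [h γ hγ]]

theorem signed_eq_neg {U : Finset Γ} {γ : Γ} (hγ : γ ∈ U) (a : 𝓐)
    {s s' : Γ → ℤˣ} (h : s γ ≠ s' γ) (hoff : ∀ δ ≠ γ, s δ = s' δ) :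
    signed U a s' = -signed U a s := by
  classical
  have hrest : ∏ δ ∈ U.erase γ, ((s' δ : ℤ) : ℂ) = ∏ δ ∈ U.erase γ, ((s δ : ℤ) : ℂ) :=
    Finset.prod_congr rfl fun δ hδ => by rw [hoff δ (Finset.ne_of_mem_erase hδ)]
  have hflip : s' γ = -s γ := Int.units_ne_iff_eq_neg.1 h.symm
  rw [signed, signed, ← Finset.mul_prod_erase U _ hγ, ← Finset.mul_prod_erase U _ hγ, hrest, hflip]
  simp [neg_smul]

theorem norm_signed_apply_le (U : Finset Γ) (a : 𝓐) (s : Γ → ℤˣ) : ‖signed U a s‖ ≤ ‖a‖ := by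
  have hsign : ∀ u : ℤˣ, ‖((u : ℤ) : ℂ)‖ = 1 := fun u => by
    rcases Int.units_eq_one_or u with rfl | rfl <;> simp
  rw [signed, norm_smul, norm_prod, Finset.prod_congr rfl fun γ _ => hsign (s γ),
    Finset.prod_const_one, one_mul]

theorem isSelfAdjoint_signed (U : Finset Γ) {a : 𝓐} (ha : IsSelfAdjoint a) :
    IsSelfAdjoint (signed U a) := by
  ext s
  simp [signed, ha.star_eq]

theorem signed_mul_signed (U W : Finset Γ) (a b : 𝓐) (s : Γ → ℤˣ) :
    signed U a s * signed W b s
      = ((∏ γ ∈ U, ((s γ : ℤ) : ℂ)) * ∏ γ ∈ W, ((s γ : ℤ) : ℂ)) • (a * b) := by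
  rw [signed, signed, smul_mul_smul_comm]

theorem commute_signed {a b : 𝓐} (h : Commute a b) (U W : Finset Γ) :
    Commute (signed U a) (signed W b) := by
  ext s
  simp only [Pi.mul_apply, signed_mul_signed, h.eq, mul_comm]

theorem signed_mul_signed_of_anticommute {a b : 𝓐} (h : a * b = -(b * a)) (U W : Finset Γ) :
    signed U a * signed W b = -(signed W b * signed U a) := by
  ext s
  simp only [Pi.mul_apply, Pi.neg_apply, signed_mul_signed, h, smul_neg, mul_comm]

/-- Self-adjoint elements that pairwise commute or anticommute, of norm at most `w`. -/
structure CommutingTerms (Y : Γ → 𝓐) (w : Γ → ℝ) : Prop where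
  isSelfAdjoint : ∀ γ, IsSelfAdjoint (Y γ)
  norm_le : ∀ γ, ‖Y γ‖ ≤ w γ
  commute_or_anticommute : ∀ γ δ, Commute (Y γ) (Y δ) ∨ Y γ * Y δ = -(Y δ * Y γ)

end SignedTerms

section Dilation

open scoped CStarAlgebra

variable {𝓐 : Type*} [CStarAlgebra 𝓐] {Γ : Type*} [Fintype Γ] [DecidableEq Γ]

theorem commute_diagonal_modeProj {B : Finset Γ} {f : (Γ → ℤˣ) → 𝓐}
    (hf : ∀ s s', (∀ γ ∉ B, s γ = s' γ) → f s = f s') :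
    Commute (diagonal f) (scalarMatrix (modeProj B)) := by
  refine CStarMatrix.ext fun s s' => ?_
  rw [diagonal_mul_apply, mul_diagonal_apply, scalarMatrix_apply]
  by_cases h : ∀ γ ∉ B, s γ = s' γ
  · rw [hf s s' h, Algebra.commutes]
  · push Not at h
    obtain ⟨γ, hγ, hne⟩ := h
    rw [modeProj_eq_zero_of_ne hγ hne, map_zero, mul_zero, zero_mul]

theorem diagonal_mul_modeProj_singleton {γ : Γ} {f : (Γ → ℤˣ) → 𝓐}
    (hf : ∀ s s', s γ ≠ s' γ → (∀ δ ≠ γ, s δ = s' δ) → f s' = -f s) :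
    diagonal f * scalarMatrix (modeProj {γ})
      = (1 - scalarMatrix (modeProj {γ})) * diagonal f := by
  refine CStarMatrix.ext fun s s' => ?_
  rw [diagonal_mul_apply, mul_diagonal_apply, CStarMatrix.sub_apply, scalarMatrix_apply]
  by_cases hoff : ∀ δ ≠ γ, s δ = s' δ
  · by_cases h : s γ = s' γ
    · obtain rfl : s = s' := funext fun δ => if hδ : δ = γ then hδ ▸ h else hoff δ hδ
      rw [CStarMatrix.one_apply_eq, modeProj_singleton_self, Algebra.algebraMap_eq_smul_one,
        mul_smul_comm, sub_mul, smul_mul_assoc, one_mul, mul_one]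
      module
    · rw [CStarMatrix.one_apply_ne (fun hs => h (congrFun hs γ)), hf s s' h hoff, zero_sub,
        neg_mul_neg, Algebra.commutes]
  · push Not at hoff
    obtain ⟨δ, hδ, hne⟩ := hoff
    rw [modeProj_eq_zero_of_ne (Finset.notMem_singleton.2 hδ) hne,
      CStarMatrix.one_apply_ne (fun hs => hne (congrFun hs δ)), map_zero, mul_zero, sub_zero,
      zero_mul]

variable [PartialOrder 𝓐] [StarOrderedRing 𝓐]

theorem norm_diagonal_signed_le (U : Finset Γ) (a : 𝓐) :
    ‖(diagonal (signed U a) : CStarMatrix (Γ → ℤˣ) (Γ → ℤˣ) 𝓐)‖ ≤ ‖a‖ :=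
  (NonUnitalStarAlgHom.norm_apply_le
    (diagonal : ((Γ → ℤˣ) → 𝓐) →⋆ₐ[ℂ] CStarMatrix (Γ → ℤˣ) (Γ → ℤˣ) 𝓐) _).trans
    ((pi_norm_le_iff_of_nonneg (norm_nonneg a)).2 (norm_signed_apply_le U a))

theorem modeProjections_modeProj : ModeProjections
    fun B : Finset Γ => (scalarMatrix (modeProj B) : CStarMatrix (Γ → ℤˣ) (Γ → ℤˣ) 𝓐) where
  empty := by rw [modeProj_empty, scalarMatrix_one]
  isStarProjection B := by
    constructor
    · rw [IsIdempotentElem, ← scalarMatrix_mul, modeProj_mul, Finset.union_self]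
    · rw [IsSelfAdjoint, star_scalarMatrix, conjTranspose_modeProj]
  mul B C := by rw [← scalarMatrix_mul, modeProj_mul]

theorem switchesModes_diagonal_signed (U : Finset Γ) (a : 𝓐) :
    SwitchesModes (fun B => scalarMatrix (modeProj B)) U (diagonal (signed U a)) :=
  fun _ hγ => diagonal_mul_modeProj_singleton fun _ _ => signed_eq_neg hγ a

theorem modeSystem_diagonal_signed {Y : Γ → 𝓐} {w : Γ → ℝ} (hY : CommutingTerms Y w) :
    ModeSystem (fun γ => (diagonal (signed {γ} (Y γ)) : CStarMatrix (Γ → ℤˣ) (Γ → ℤˣ) 𝓐)) w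
      fun B => scalarMatrix (modeProj B) where
  toModeProjections := modeProjections_modeProj
  isSelfAdjoint γ := (isSelfAdjoint_signed {γ} (hY.isSelfAdjoint γ)).map diagonal
  norm_le γ := (norm_diagonal_signed_le {γ} (Y γ)).trans (hY.norm_le γ)
  commute_or_anticommute γ δ := by
    refine (hY.commute_or_anticommute γ δ).imp (fun h => (commute_signed h {γ} {δ}).map diagonal)
      fun h => ?_
    rw [← map_mul, signed_mul_signed_of_anticommute h, map_neg, map_mul]
  commute {γ B} hγ := commute_diagonal_modeProj fun s s' h => signed_congr _ fun δ hδ =>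
    h δ (Finset.mem_singleton.1 hδ ▸ hγ)
  toggle γ := switchesModes_diagonal_signed {γ} (Y γ) γ (Finset.mem_singleton_self γ)

variable {J : Type*} [Fintype J] {φ : 𝓐 →ₚ[ℂ] ℂ} {Y : Γ → 𝓐} {w : Γ → ℝ} {A : J → 𝓐}
  {c : J → Γ → ℝ} {l : ℝ}

theorem vacuumEvolution_diagonal_signed (hφ : φ 1 = 1) (hY : CommutingTerms Y w)
    (hA : ∀ a, star (A a) * A a = 1) (hc : WeakCoupling c w l) :
    VacuumEvolution (uniformState φ) (fun γ => diagonal (signed {γ} (Y γ))) w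
      (fun B => scalarMatrix (modeProj B)) (fun a => diagonal fun _ : Γ → ℤˣ => A a) c l where
  toModeSystem := modeSystem_diagonal_signed hY
  toWeakCoupling := hc
  isometry a := by
    rw [← map_star, ← map_mul, ← map_one diagonal]
    exact congrArg diagonal (funext fun _ => hA a)
  commute_jump a B := commute_diagonal_modeProj fun _ _ _ => rfl
  map_one := by
    rw [← map_one diagonal, uniformState_diagonal]
    simp [hφ]
  map_proj B hB := by
    rw [uniformState_scalarMatrix hφ]
    simp only [sum_modeProj_of_nonempty hB, Finset.sum_const_zero, mul_zero]

theorem uniformState_exp_gksl_diagonal {n : Type*} [Fintype n] [DecidableEq n] (φ : 𝓐 →ₚ[ℂ] ℂ)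
    (K : J → n → 𝓐) (z : ℂ) (f : n → 𝓐) :
    uniformState φ (exp (z • gksl fun a => diagonal (K a)) (diagonal f))
      = (Fintype.card n : ℂ)⁻¹ * ∑ i, φ (exp (z • gksl fun a => K a i) (f i)) := by
  have hevolve : ∀ i, exp (z • gksl K) f i = exp (z • gksl fun a => K a i) (f i) := fun i =>
    map_exp_smul_gksl (Pi.evalStarAlgHom ℂ (fun _ : n => 𝓐) i) K z f
  have hdiagonal := map_exp_smul_gksl (diagonal : (n → 𝓐) →⋆ₐ[ℂ] CStarMatrix n n 𝓐) K z f
  rw [← hdiagonal, uniformState_diagonal]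
  simp only [hevolve]

theorem signExpectation_eq_uniformState (φ : 𝓐 →ₚ[ℂ] ℂ) (Y : Γ → 𝓐) (A : J → 𝓐) (c : J → Γ → ℝ)
    (U : Finset Γ) (z : ℂ) (x : 𝓐) :
    (signExpectation fun s : Γ → ℤˣ => (∏ γ ∈ U, ((s γ : ℤ) : ℂ)) •
        φ (exp (z • gksl (modeJump (fun γ => ((s γ : ℤ) : ℂ) • Y γ) A c)) x))
      = uniformState φ (exp (z • gksl (modeJump
          (fun γ => diagonal (signed {γ} (Y γ))) (fun a => diagonal fun _ => A a) c))
          (diagonal (signed U x))) := by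
  have hdiagonal := funext fun a => map_modeJump
    (diagonal : ((Γ → ℤˣ) → 𝓐) →⋆ₐ[ℂ] CStarMatrix (Γ → ℤˣ) (Γ → ℤˣ) 𝓐)
    (fun γ => signed {γ} (Y γ)) (fun (a : J) _ => A a) c a
  have heval : ∀ s : Γ → ℤˣ, modeJump (fun γ => ((s γ : ℤ) : ℂ) • Y γ) A c
      = fun a => modeJump (fun γ => signed {γ} (Y γ)) (fun (a : J) _ => A a) c a s := fun s =>
    funext fun a => by
      simp only [← signed_singleton]
      exact (map_modeJump (Pi.evalStarAlgHom ℂ (fun _ => 𝓐) s) (fun γ => signed {γ} (Y γ))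
        (fun a _ => A a) c a).symm
  rw [← hdiagonal, uniformState_exp_gksl_diagonal, signExpectation, smul_eq_mul]
  simp only [heval, signed, map_smul]

theorem norm_signExpectation_le (hφ : φ 1 = 1) (hY : CommutingTerms Y w)
    (hA : ∀ a, star (A a) * A a = 1) (hc : WeakCoupling c w l) {t : ℝ} (ht : 0 ≤ t)
    (hlt : l * t ≤ 1) (U : Finset Γ) (x : 𝓐) :
    ‖signExpectation fun s : Γ → ℤˣ => (∏ γ ∈ U, ((s γ : ℤ) : ℂ)) •
        φ (exp ((t : ℂ) • gksl (modeJump (fun γ => ((s γ : ℤ) : ℂ) • Y γ) A c)) x)‖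
      ≤ 2 ^ U.card * momentBound U.card * ‖x‖ * ∏ γ ∈ U, w γ := by
  have hV := vacuumEvolution_diagonal_signed hφ hY hA hc
  have hw : 0 ≤ ∏ γ ∈ U, w γ := Finset.prod_nonneg fun γ _ => hV.weight_nonneg γ
  have hM : 0 ≤ momentBound U.card := zero_le_one.trans (one_le_momentBound _)
  rw [signExpectation_eq_uniformState]
  refine (hV.norm_evolvedState_le ht hlt (switchesModes_diagonal_signed U x)).trans ?_
  gcongr
  exact norm_diagonal_signed_le U x

end Dilation

section TracialState

variable (V : Type*) [NormedAddCommGroup V] [InnerProductSpace ℂ V] [FiniteDimensional ℂ V]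

theorem normalizedTrace_one [Nontrivial V] : normalizedTrace V 1 = 1 := by
  have htrace : LinearMap.trace ℂ V 1 ≠ 0 := by
    rw [LinearMap.trace_one]
    exact Nat.cast_ne_zero.2 Module.finrank_pos.ne'
  rw [normalizedTrace_apply]
  exact div_self htrace

theorem normalizedTrace_nonneg {O : V →L[ℂ] V} (hO : 0 ≤ O) : 0 ≤ normalizedTrace V O := by
  rw [normalizedTrace_apply]
  exact div_nonneg (O.nonneg_iff_isPositive.1 hO).toLinearMap.trace_nonneg (by simp)

/-- The normalized trace as a positive functional. -/
noncomputable def tracialState [CompleteSpace V] : (V →L[ℂ] V) →ₚ[ℂ] ℂ :=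
  PositiveLinearMap.mk₀ (normalizedTrace V).toLinearMap fun _ => normalizedTrace_nonneg V

end TracialState

section Model

variable {V : Type*} [NormedAddCommGroup V] [InnerProductSpace ℂ V] {Γ J : Type*} {n : ℕ}
  {site : Fin n → Set (V →L[ℂ] V)} {H : Γ → V →L[ℂ] V} {h : Γ → ℝ} {A : J → V →L[ℂ] V}
  {b : J → Γ → ℕ} {b' : Γ → Γ → ℕ} {k : ℕ} {aloc aac : ℝ}

theorem sum_sq_le_localEnergy_sq [Fintype Γ] (site : Fin n → Set (V →L[ℂ] V)) (H : Γ → V →L[ℂ] V)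
    (h : Γ → ℝ) (i : Fin n) :
    ∑ γ with i ∈ opSupport site (H γ), h γ ^ 2 ≤ localEnergy site H h ^ 2 :=
  (Real.sqrt_le_iff.1 (le_ciSup (f := fun i => √(∑ γ with i ∈ opSupport site (H γ), h γ ^ 2))
    (Set.finite_range _).bddAbove i)).2

namespace LocalJumps

variable [Fintype J] (hL : LocalJumps site H A b k aloc aac)
include hL

theorem exists_natCast_eq_aloc (i : Fin n) : ∃ m : ℕ, aloc = m :=
  ⟨_, by simpa using (hL.card_jumps {i}).symm⟩

theorem aloc_mul_nonneg (γ : Γ) : 0 ≤ aloc * k := by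
  rcases (opSupport site (H γ)).eq_empty_or_nonempty with hempty | ⟨i, -⟩
  · simp [← hL.term_card γ, hempty]
  · obtain ⟨m, rfl⟩ := hL.exists_natCast_eq_aloc i
    positivity

theorem sum_le_aloc_mul (γ : Γ) : ∑ a, (b a γ : ℝ) ≤ aloc * k := by
  rw [hL.sum_anticommuting]
  exact mul_le_mul_of_nonneg_right hL.aac_le_aloc k.cast_nonneg

theorem one_le_aloc_mul {a : J} {γ : Γ} (hb : b a γ ≠ 0) (i : Fin n) : 1 ≤ aloc * k := by
  have hpos : 0 < aloc * k := calc
    (0 : ℝ) < b a γ := Nat.cast_pos.2 (Nat.pos_of_ne_zero hb)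
    _ ≤ ∑ a, (b a γ : ℝ) :=
      Finset.single_le_sum (f := fun a => (b a γ : ℝ)) (fun _ _ => Nat.cast_nonneg _)
        (Finset.mem_univ a)
    _ ≤ aloc * k := hL.sum_le_aloc_mul γ
  obtain ⟨m, rfl⟩ := hL.exists_natCast_eq_aloc i
  exact_mod_cast hpos

end LocalJumps

variable [CompleteSpace V]

theorem SymmetricTerms.norm_le (hH : SymmetricTerms H h) (γ : Γ) : ‖H γ‖ ≤ h γ := by
  refine abs_le_of_sq_le_sq' ?_ (hH.strength_nonneg γ) |>.2
  have hsq : ‖H γ‖ ^ 2 = ‖((h γ ^ 2 : ℝ) : ℂ) • (1 : V →L[ℂ] V)‖ := by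
    rw [← hH.sq_eq, sq, ← CStarRing.norm_star_mul_self, (hH.selfAdjoint γ).star_eq]
  rw [hsq, norm_smul, Complex.norm_of_nonneg (sq_nonneg _)]
  exact mul_le_of_le_one_right (sq_nonneg _) ContinuousLinearMap.norm_id_le

namespace CommuteOrAnticommute

variable (hC : CommuteOrAnticommute site H A b b')
include hC

theorem commute_or_anticommute (γ δ : Γ) :
    Commute (H γ) (H δ) ∨ H γ * H δ = -(H δ * H γ) := by
  have hcomm := hC.term_comm γ δ
  rcases hC.term_zero_or_one γ δ with hb | hb <;> rw [hb] at hcomm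
  · left
    simpa [sub_eq_zero, commute_iff_eq] using hcomm
  · right
    rw [Nat.cast_one, one_mul, two_smul, sub_eq_iff_eq_add, add_assoc, left_eq_add] at hcomm
    exact eq_neg_of_add_eq_zero_left hcomm

theorem commutingTerms (hH : SymmetricTerms H h) (y : ℝ) :
    CommutingTerms (fun γ => (y : ℂ) • H γ) fun γ => |y| * h γ where
  isSelfAdjoint γ := IsSelfAdjoint.smul (Complex.conj_ofReal y) (hH.selfAdjoint γ)
  norm_le γ := by
    rw [norm_smul, Complex.norm_real, Real.norm_eq_abs]
    exact mul_le_mul_of_nonneg_left (hH.norm_le γ) (abs_nonneg y)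
  commute_or_anticommute γ δ := by
    refine (hC.commute_or_anticommute γ δ).imp (fun h => (h.smul_left _).smul_right _) fun h => ?_
    rw [smul_mul_smul_comm, smul_mul_smul_comm, h, smul_neg]

theorem exists_forall_mem_opSupport [Fintype J] (hL : LocalJumps site H A b k aloc aac) (a : J) :
    ∃ i, ∀ γ, b a γ ≠ 0 → i ∈ opSupport site (H γ) := by
  obtain ⟨i, hi⟩ := Finset.card_eq_one.1 (hL.jump_card a)
  refine ⟨i, fun γ hγ => ?_⟩
  contrapose! hγ
  exact hC.jump_disjoint a γ (by rwa [hi, Finset.disjoint_singleton_left])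

variable [Fintype Γ]

theorem lindbladOp_eq_modeJump (y : ℝ) (s : Γ → ℤˣ) (a : J) :
    lindbladOp y (A a) (hamiltonian H s)
      = modeJump (fun γ => ((s γ : ℤ) : ℂ) • (y : ℂ) • H γ) A (fun a γ => (b a γ : ℝ)) a := by
  have hcomm : (y : ℂ) • (A a * hamiltonian H s - hamiltonian H s * A a)
      = A a * (2 : ℂ) • couplingSum (fun γ => ((s γ : ℤ) : ℂ) • (y : ℂ) • H γ) fun γ => b a γ := by
    rw [hamiltonian, couplingSum, Finset.mul_sum, Finset.sum_mul, ← Finset.sum_sub_distrib,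
      Finset.smul_sum, Finset.smul_sum, Finset.mul_sum]
    refine Finset.sum_congr rfl fun γ _ => ?_
    simp only [mul_smul_comm, smul_mul_assoc, ← smul_sub, hC.jump_comm, Complex.ofReal_natCast]
    module
  rw [lindbladOp, hcomm, modeJump, mul_add, mul_one]

variable [Fintype J]

theorem lindbladian_eq_gksl (y : ℝ) (s : Γ → ℤˣ) :
    lindbladian H A y s
      = gksl (modeJump (fun γ => ((s γ : ℤ) : ℂ) • (y : ℂ) • H γ) A fun a γ => (b a γ : ℝ)) := by
  ext1 O
  rw [gksl_apply, lindbladian, _root_.sum_apply]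
  simp only [dissipator_apply, hC.lindbladOp_eq_modeJump]

theorem sum_mul_sq_le [Nonempty Γ] (hL : LocalJumps site H A b k aloc aac) (a : J) :
    ∑ γ, (b a γ : ℝ) * h γ ^ 2 ≤ localEnergy site H h ^ 2 * (aloc * k) := by
  by_cases hb : ∀ γ, b a γ = 0
  · simp only [hb, Nat.cast_zero, zero_mul, Finset.sum_const_zero]
    exact mul_nonneg (sq_nonneg _) (hL.aloc_mul_nonneg (Classical.arbitrary Γ))
  push Not at hb
  obtain ⟨γ₀, hγ₀⟩ := hb
  obtain ⟨i, hi⟩ := hC.exists_forall_mem_opSupport hL a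
  calc ∑ γ, (b a γ : ℝ) * h γ ^ 2
    _ ≤ ∑ γ with i ∈ opSupport site (H γ), h γ ^ 2 := by
      rw [Finset.sum_filter]
      refine Finset.sum_le_sum fun γ _ => ?_
      rcases hC.jump_zero_or_one a γ with hb | hb
      · rw [hb, Nat.cast_zero, zero_mul]
        split_ifs <;> positivity
      · rw [if_pos (hi γ (by simp [hb])), hb, Nat.cast_one, one_mul]
    _ ≤ localEnergy site H h ^ 2 := sum_sq_le_localEnergy_sq site H h i
    _ ≤ localEnergy site H h ^ 2 * (aloc * k) :=
      le_mul_of_one_le_right (sq_nonneg _) (hL.one_le_aloc_mul hγ₀ i)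

theorem weakCoupling [Nonempty Γ] (hL : LocalJumps site H A b k aloc aac) {y : ℝ}
    (hy : y ^ 2 * localEnergy site H h ^ 2 * aloc * k < 1 / 8) :
    WeakCoupling (fun a γ => (b a γ : ℝ)) (fun γ => |y| * h γ) (aloc * k) where
  nonneg _ _ := Nat.cast_nonneg _
  le_one a γ := by rcases hC.jump_zero_or_one a γ with hb | hb <;> simp [hb]
  sum_mul_sq_le a := calc
    ∑ γ, (b a γ : ℝ) * (|y| * h γ) ^ 2 = y ^ 2 * ∑ γ, (b a γ : ℝ) * h γ ^ 2 := by
      simp only [mul_pow, sq_abs, Finset.mul_sum, mul_left_comm]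
    _ ≤ y ^ 2 * (localEnergy site H h ^ 2 * (aloc * k)) :=
      mul_le_mul_of_nonneg_left (hC.sum_mul_sq_le hL a) (sq_nonneg y)
    _ ≤ 1 / 8 := by linarith
  sum_le := hL.sum_le_aloc_mul
  rate_nonneg := hL.aloc_mul_nonneg (Classical.arbitrary Γ)

theorem exists_weakCoupling (hL : LocalJumps site H A b k aloc aac) {y t : ℝ}
    (hlt : aloc * k * t < 1) (hy : y ^ 2 * localEnergy site H h ^ 2 * aloc * k < 1 / 8) :
    ∃ l, WeakCoupling (fun a γ => (b a γ : ℝ)) (fun γ => |y| * h γ) l ∧ l * t ≤ 1 := by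
  rcases isEmpty_or_nonempty Γ with hΓ | hΓ
  · exact ⟨0, ⟨fun _ => hΓ.elim, fun _ => hΓ.elim, fun _ => by simp, hΓ.elim, le_rfl⟩, by simp⟩
  · exact ⟨aloc * k, hC.weakCoupling hL hy, hlt.le⟩

end CommuteOrAnticommute

end Model

section DoubleIntegral

variable {E F : Type*} [NormedAddCommGroup E] [NormedSpace ℂ E] [NormedAddCommGroup F]
  [NormedSpace ℂ F]

theorem norm_doubleIntegral_le {f : ℝ → E} {c t : ℝ} (ht : 0 ≤ t)
    (hf : ∀ r ∈ Set.Icc 0 t, ‖f r‖ ≤ c) :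
    ‖∫ t₂ in (0 : ℝ)..t, ∫ t₁ in (0 : ℝ)..t₂, f t₁‖ ≤ c * t ^ 2 := by
  have hc : 0 ≤ c := (norm_nonneg _).trans (hf 0 ⟨le_rfl, ht⟩)
  have hinner : ∀ t₂ ∈ Set.uIoc 0 t, ‖∫ t₁ in (0 : ℝ)..t₂, f t₁‖ ≤ c * t := by
    intro t₂ ht₂
    rw [Set.uIoc_of_le ht] at ht₂
    calc ‖∫ t₁ in (0 : ℝ)..t₂, f t₁‖ ≤ c * |t₂ - 0| :=
          intervalIntegral.norm_integral_le_of_norm_le_const fun r hr => by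
            rw [Set.uIoc_of_le ht₂.1.le] at hr
            exact hf r ⟨hr.1.le, hr.2.trans ht₂.2⟩
      _ ≤ c * t := by
        rw [sub_zero, abs_of_pos ht₂.1]
        exact mul_le_mul_of_nonneg_left ht₂.2 hc
  calc ‖∫ t₂ in (0 : ℝ)..t, ∫ t₁ in (0 : ℝ)..t₂, f t₁‖ ≤ c * t * |t - 0| :=
        intervalIntegral.norm_integral_le_of_norm_le_const hinner
    _ = c * t ^ 2 := by rw [sub_zero, abs_of_nonneg ht, mul_assoc, ← sq]

theorem sum_doubleIntegral {ι : Type*} (s : Finset ι) {f : ι → ℝ → E}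
    (hf : ∀ i, Continuous (f i)) (t : ℝ) :
    ∑ i ∈ s, ∫ t₂ in (0 : ℝ)..t, ∫ t₁ in (0 : ℝ)..t₂, f i t₁ =
      ∫ t₂ in (0 : ℝ)..t, ∫ t₁ in (0 : ℝ)..t₂, ∑ i ∈ s, f i t₁ := by
  have hprimitive : ∀ i, Continuous fun t₂ => ∫ t₁ in (0 : ℝ)..t₂, f i t₁ := fun i =>
    intervalIntegral.continuous_primitive (fun a b => (hf i).intervalIntegrable a b) 0
  rw [← intervalIntegral.integral_finsetSum fun i _ => (hprimitive i).intervalIntegrable 0 t]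
  exact intervalIntegral.integral_congr fun t₂ _ =>
    (intervalIntegral.integral_finsetSum fun i _ => (hf i).intervalIntegrable 0 t₂).symm

theorem map_doubleIntegral [CompleteSpace E] [CompleteSpace F] (D : E →L[ℂ] F) {f : ℝ → E}
    (hf : Continuous f) (t : ℝ) :
    D (∫ t₂ in (0 : ℝ)..t, ∫ t₁ in (0 : ℝ)..t₂, f t₁) =
      ∫ t₂ in (0 : ℝ)..t, ∫ t₁ in (0 : ℝ)..t₂, D (f t₁) := by
  have hprimitive : Continuous fun t₂ => ∫ t₁ in (0 : ℝ)..t₂, f t₁ :=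
    intervalIntegral.continuous_primitive (fun a b => hf.intervalIntegrable a b) 0
  rw [← D.intervalIntegral_comp_comm (hprimitive.intervalIntegrable 0 t)]
  exact intervalIntegral.integral_congr fun t₂ _ =>
    (D.intervalIntegral_comp_comm (hf.intervalIntegrable 0 t₂)).symm

end DoubleIntegral

section SignedIntegral

variable {V : Type*} [NormedAddCommGroup V] [InnerProductSpace ℂ V] [CompleteSpace V]
  [FiniteDimensional ℂ V] {Γ J : Type*} [Fintype Γ] [DecidableEq Γ] [Fintype J]

theorem signedIntegral_apply (H : Γ → V →L[ℂ] V) (A : J → V →L[ℂ] V) (y t : ℝ) (U : Finset Γ)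
    (O : V →L[ℂ] V) :
    signedIntegral H A y t U O = ∫ t₂ in (0 : ℝ)..t, ∫ t₁ in (0 : ℝ)..t₂,
      signExpectation fun s : Γ → ℤˣ => (∏ γ ∈ U, ((s γ : ℤ) : ℂ)) •
        tracialState V (exp ((t₁ : ℂ) • lindbladian H A y s) O) := by
  let D : (Γ → ℤˣ) → ((V →L[ℂ] V) →L[ℂ] (V →L[ℂ] V)) →L[ℂ] ℂ := fun s =>
    (Fintype.card (Γ → ℤˣ) : ℂ)⁻¹ • (∏ γ ∈ U, ((s γ : ℤ) : ℂ)) •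
      (normalizedTrace V).comp (ContinuousLinearMap.apply ℂ (V →L[ℂ] V) O)
  have hexp : ∀ s, Continuous fun r : ℝ => exp ((r : ℂ) • lindbladian H A y s) := fun s =>
    (differentiable_exp_smul_const ℂ (lindbladian H A y s)).continuous.comp
      Complex.continuous_ofReal
  calc signedIntegral H A y t U O
    _ = ∑ s, D s (∫ t₂ in (0 : ℝ)..t, ∫ t₁ in (0 : ℝ)..t₂,
          exp ((t₁ : ℂ) • lindbladian H A y s)) := by
      rw [signedIntegral, signExpectation, _root_.smul_apply, _root_.sum_apply, Finset.smul_sum]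
      rfl
    _ = ∑ s, ∫ t₂ in (0 : ℝ)..t, ∫ t₁ in (0 : ℝ)..t₂,
          D s (exp ((t₁ : ℂ) • lindbladian H A y s)) :=
      Finset.sum_congr rfl fun s _ => map_doubleIntegral (D s) (hexp s) t
    _ = ∫ t₂ in (0 : ℝ)..t, ∫ t₁ in (0 : ℝ)..t₂,
          ∑ s, D s (exp ((t₁ : ℂ) • lindbladian H A y s)) :=
      sum_doubleIntegral _ (fun s => (D s).continuous.comp (hexp s)) t
    _ = _ := by
      simp only [signExpectation, Finset.smul_sum]
      rfl

variable [Nontrivial V] {n : ℕ} {site : Fin n → Set (V →L[ℂ] V)} {H : Γ → V →L[ℂ] V} {h : Γ → ℝ}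
  {A : J → V →L[ℂ] V} {b : J → Γ → ℕ} {b' : Γ → Γ → ℕ} {k : ℕ} {aloc aac : ℝ}

theorem norm_signedIntegral_le (hH : SymmetricTerms H h) (hC : CommuteOrAnticommute site H A b b')
    (hL : LocalJumps site H A b k aloc aac) {y t : ℝ} (ht : 0 ≤ t) (hlt : aloc * k * t < 1)
    (hy : y ^ 2 * localEnergy site H h ^ 2 * aloc * k < 1 / 8) (U : Finset Γ) :
    ‖signedIntegral H A y t U‖
      ≤ 2 ^ U.card * momentBound U.card * t ^ 2 * |y| ^ U.card * ∏ γ ∈ U, h γ := by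
  obtain ⟨l, hc, hlt⟩ := hC.exists_weakCoupling hL hlt hy
  have hh : 0 ≤ ∏ γ ∈ U, h γ := Finset.prod_nonneg fun γ _ => hH.strength_nonneg γ
  have hM : 0 ≤ momentBound U.card := zero_le_one.trans (one_le_momentBound _)
  have hA : ∀ a, star (A a) * A a = 1 := fun a => by
    rw [(hC.jump_selfAdjoint a).star_eq, hC.jump_sq]
  refine ContinuousLinearMap.opNorm_le_bound _ (by positivity) fun O => ?_
  rw [signedIntegral_apply]
  simp only [hC.lindbladian_eq_gksl]
  refine (norm_doubleIntegral_le ht fun r hr => norm_signExpectation_le (normalizedTrace_one V)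
    (hC.commutingTerms hH y) hA hc hr.1
    ((mul_le_mul_of_nonneg_left hr.2 hc.rate_nonneg).trans hlt) U O).trans_eq ?_
  rw [Finset.prod_mul_distrib, Finset.prod_const]
  ring

end SignedIntegral

end RandomLindblad

theorem mainTheorem4_general (m : ℕ) :
    ∃ C : ℝ,
      ∀ (V : Type*) [NormedAddCommGroup V] [InnerProductSpace ℂ V] [CompleteSpace V]
        [FiniteDimensional ℂ V] [Nontrivial V]
        (Γ : Type*) [Fintype Γ] [DecidableEq Γ] (J : Type*) [Fintype J]
        (n : ℕ) (site : Fin n → Set (V →L[ℂ] V))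
        (H : Γ → V →L[ℂ] V) (h : Γ → ℝ) (A : J → V →L[ℂ] V)
        (b : J → Γ → ℕ) (b' : Γ → Γ → ℕ) (k : ℕ) (aloc aac : ℝ),
        RandomLindblad.SymmetricTerms H h →
        RandomLindblad.CommuteOrAnticommute site H A b b' →
        RandomLindblad.LocalJumps site H A b k aloc aac →
        ∀ (y t : ℝ), 0 ≤ t → aloc * k * t < 1 →
          y ^ 2 * RandomLindblad.localEnergy site H h ^ 2 * aloc * k < 1 / 8 →
          ∀ U : Finset Γ, U.card ≤ m →
            ‖RandomLindblad.signedIntegral H A y t U‖ ≤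
              C * t ^ 2 * |y| ^ U.card * ∏ α ∈ U, h α := by
  refine ⟨2 ^ m * RandomLindblad.momentBound m, ?_⟩
  intro V _ _ _ _ _ Γ _ _ J _ n site H h A b b' k aloc aac hH hC hL y t ht hlt hy U hU
  refine (RandomLindblad.norm_signedIntegral_le hH hC hL ht hlt hy U).trans ?_
  have hh : 0 ≤ ∏ γ ∈ U, h γ := Finset.prod_nonneg fun γ _ => hH.strength_nonneg γ
  have hM : 0 ≤ RandomLindblad.momentBound U.card :=
    zero_le_one.trans (RandomLindblad.one_le_momentBound _)
  gcongr
  · exact one_le_two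
  · exact RandomLindblad.momentBound_mono hU

theorem mainTheorem4 :
    ∃ C : ℝ,
      ∀ (V : Type*) [NormedAddCommGroup V] [InnerProductSpace ℂ V] [CompleteSpace V]
        [FiniteDimensional ℂ V] [Nontrivial V]
        (Γ : Type*) [Fintype Γ] [DecidableEq Γ] (J : Type*) [Fintype J]
        (n : ℕ) (site : Fin n → Set (V →L[ℂ] V))
        (H : Γ → V →L[ℂ] V) (h : Γ → ℝ) (A : J → V →L[ℂ] V)
        (b : J → Γ → ℕ) (b' : Γ → Γ → ℕ) (k : ℕ) (aloc aac : ℝ),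
        RandomLindblad.SymmetricTerms H h →
        RandomLindblad.CommuteOrAnticommute site H A b b' →
        RandomLindblad.LocalJumps site H A b k aloc aac →
        ∀ (y t : ℝ), 0 ≤ t → aloc * k * t < 1 →
          y ^ 2 * RandomLindblad.localEnergy site H h ^ 2 * aloc * k < 1 / 8 →
          ∀ U : Finset Γ, U.card ≤ 5 →
            ‖RandomLindblad.signedIntegral H A y t U‖ ≤
              C * t ^ 2 * |y| ^ U.card * ∏ α ∈ U, h α :=
  mainTheorem4_general 5
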